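/- **Setting.** Let $(X_i,Y_i)$, $i=1,2,\dots$, be i.i.d. copies of $(X,Y)$, where $X\in\mathbb R^f$ is a feature vector and $Y=(Y^{(1)},\dots,Y^{(c)})\in\{0,1\}^c$ is the class identification vector. Among the first $n$ observations only the first $r=r_n\le n$ are labeled ($Y_i$ is observed for $i\le r$ only), and $r/n\to\gamma>0$ as $n\to\infty$. Fix a class $j$, put $q_j=E[Y^{(j)}]$, and assume $P(Y^{(j)}=1\mid X)=g(X,\theta_j)$ almost surely, where $g:\mathbb R^f\times\mathbb R^p\to\mathbb R$ is measurable and $\theta_j$ lies in a parameter set $\Theta\subseteq\mathbb R^p$. Write $g'$ for the gradient of $g$ in its second argument, $w(t,\theta)=1/\{g(t,\theta)[1-g(t,\theta)]\}$, $\psi(t,y,\theta)=w(t,\theta)\{y-g(t,\theta)\}g'(t,\theta)$, and $$A_j=E\{w(X,\theta_j)\,g'(X,\theta_j)\,g'(X,\theta_j)^T\},\qquad B_j=E[g'(X,\theta_j)].$$ **Regularity.** For almost every value $t$ of $X$, $0<g(t,\theta)<1$ for all $\theta\in\Theta$. There are an open set $U$ with $\theta_j\in U\subseteq\Theta$ and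 a function $M$ with $E[M(X)]<\infty$ such that, for almost every value $t$ of $X$, $g(t,\cdot)$ is twice continuously differentiable on $U$ and $\|g'(t,\theta)\|\le M(t)$ and $\|\partial_\theta\psi(t,y,\theta)\|\le M(t)$ for all $\theta\in U$ and $y\in\{0,1\}$. Moreover $E[w(X,\theta_j)\|g'(X,\theta_j)\|^2]<\infty$ and $A_j$ is invertible. **Estimators.** The estimator $\hat\theta_j=\hat\theta_{j,n}$ is the root in $\Theta$ of the weighted least squares estimating equation $$\sum_{i=1}^{r}w(X_i,\theta)\{Y_i^{(j)}-g(X_i,\theta)\}g'(X_i,\theta)=0.$$ That is: the probability that this equation has more than one root in $\Theta$ tends to $0$ as $n\to\infty$, and $\hat\theta_j$ is a random vector which is a root in $\Theta$ whenever a root in $\Theta$ exists. (Neither the existence of a root nor the consistency of $\hat\theta_j$ is assumed.) Put $$\hat q_j=\frac1n\sum_{i=1}^n g(X_i,\hat\theta_j),\qquad AVar(\hat q_j)=\frac1n Var[g(X,\theta_j)]+\frac1r B_j^TA_j^{-1}B_j .$$ **Theorem.** The estimator $\hat q_j$ is asymptotically normal with asymptotic variance $AVar(\hat q_j)$. Precisely,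 let $\sigma^2=Var[g(X,\theta_j)]+\gamma^{-1}B_j^TA_j^{-1}B_j$. Then $\sigma^2\ge 0$ and, as $n\to\infty$: 1. $n\,AVar(\hat q_j)\to\sigma^2$ and $\sqrt n(\hat q_j-q_j)\to N(0,\sigma^2)$ in distribution; 2. if $\sigma^2>0$, then $(\hat q_j-q_j)/\sqrt{AVar(\hat q_j)}\to N(0,1)$ in distribution; 3. $\sqrt n\,(\hat q_j-q_j-L_n-S_n)\to 0$ in probability, where $$L_n=\frac1n\sum_{i=1}^n\{g(X_i,\theta_j)-q_j\},\qquad S_n=\frac1r B_j^TA_j^{-1}\sum_{i=1}^r w(X_i,\theta_j)\{Y_i^{(j)}-g(X_i,\theta_j)\}g'(X_i,\theta_j).$$ Moreover, whenever $r\ge1$, the full-sample term $L_n$ and the labeled-score term $S_n$ are square integrable and uncorrelated, with $Var(L_n)=\frac1n Var[g(X,\theta_j)]$ and $Var(S_n)=\frac1r B_j^TA_j^{-1}B_j$. -/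

import Mathlib

open MeasureTheory ProbabilityTheory Filter Topology
open scoped Matrix

noncomputable section

namespace PriorEstimation

/-- Feature vectors: `f` real features. -/
abbrev Feature (f : ℕ) := Fin f → ℝ

/-- Parameter vectors: Euclidean space of dimension `p`. -/
abbrev Param (p : ℕ) := EuclideanSpace ℝ (Fin p)

/-- The weight `w(t,θ) = 1 / (g(t,θ) (1 - g(t,θ)))`. -/
def weight {f p : ℕ} (g : Feature f → Param p → ℝ) (t : Feature f) (θ : Param p) : ℝ :=
  1 / (g t θ * (1 - g t θ))

/-- The summand `w(t,θ) (y - g(t,θ)) g'(t,θ)` of the estimating equation; `g'` is the gradient of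
`g` in its second argument. -/
def score {f p : ℕ} (g : Feature f → Param p → ℝ) (t : Feature f) (y : ℝ) (θ : Param p) :
    Param p :=
  (weight g t θ * (y - g t θ)) • gradient (g t) θ

/-- `θ` is a root of the weighted least squares estimating equation built from the first `r`
(labeled) observations `(x i, y i)`. -/
def IsLabeledRoot {f p : ℕ} (g : Feature f → Param p → ℝ) (r : ℕ) (x : ℕ → Feature f) (y : ℕ → ℝ)
    (θ : Param p) : Prop :=
  ∑ i ∈ Finset.range r, score g (x i) (y i) θ = 0

/-- `q̂ = n⁻¹ ∑ g(X_i, θ̂)`, over all `n` (labeled and unlabeled) feature vectors. -/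
def priorEstimate {f p : ℕ} (g : Feature f → Param p → ℝ) (n : ℕ) (x : ℕ → Feature f)
    (θ : Param p) : ℝ :=
  (1 / (n : ℝ)) * ∑ i ∈ Finset.range n, g (x i) θ

section Population

variable {Ω : Type*} [MeasurableSpace Ω]

/-- `A = E[w(X,θ) g'(X,θ) g'(X,θ)ᵀ]`. -/
def matA {f p : ℕ} (μ : Measure Ω) (g : Feature f → Param p → ℝ) (X : Ω → Feature f)
    (θ : Param p) : Matrix (Fin p) (Fin p) ℝ :=
  Matrix.of fun a b => ∫ ω, weight g (X ω) θ * gradient (g (X ω)) θ a * gradient (g (X ω)) θ b ∂μ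

/-- `B = E[g'(X,θ)]`. -/
def vecB {f p : ℕ} (μ : Measure Ω) (g : Feature f → Param p → ℝ) (X : Ω → Feature f)
    (θ : Param p) : Fin p → ℝ :=
  fun a => ∫ ω, gradient (g (X ω)) θ a ∂μ

/-- `Bᵀ A⁻¹ B`. -/
def quadBAB {f p : ℕ} (μ : Measure Ω) (g : Feature f → Param p → ℝ) (X : Ω → Feature f)
    (θ : Param p) : ℝ :=
  vecB μ g X θ ⬝ᵥ ((matA μ g X θ)⁻¹ *ᵥ vecB μ g X θ)

/-- `(1/n) Var[g(X,θ)] + (1/r) Bᵀ A⁻¹ B`. -/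
def avar {f p : ℕ} (μ : Measure Ω) (g : Feature f → Param p → ℝ) (X : Ω → Feature f)
    (θ : Param p) (n r : ℕ) : ℝ :=
  (1 / (n : ℝ)) * Var[fun ω => g (X ω) θ; μ] + (1 / (r : ℝ)) * quadBAB μ g X θ

/-- The full-sample term `n⁻¹ ∑_{i<n} (g(X_i,θ) - q)`. -/
def fullSampleTerm {f p : ℕ} (g : Feature f → Param p → ℝ) (X : ℕ → Ω → Feature f)
    (θ : Param p) (q : ℝ) (n : ℕ) (ω : Ω) : ℝ :=
  (1 / (n : ℝ)) * ∑ i ∈ Finset.range n, (g (X i ω) θ - q)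

/-- The labeled-score term `r⁻¹ Bᵀ A⁻¹ ∑_{i<r} w(X_i,θ) (Y_i - g(X_i,θ)) g'(X_i,θ)`. -/
def labeledScoreTerm {f p : ℕ} (μ : Measure Ω) (g : Feature f → Param p → ℝ)
    (X : ℕ → Ω → Feature f) (Y : ℕ → Ω → ℝ) (θ : Param p) (r : ℕ) (ω : Ω) : ℝ :=
  (1 / (r : ℝ)) * (vecB μ g (X 0) θ ⬝ᵥ ((matA μ g (X 0) θ)⁻¹ *ᵥ
    fun a => ∑ i ∈ Finset.range r, score g (X i ω) (Y i ω) θ a))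

end Population

/-- Regularity of the family `g` at the true parameter `θ₀`, an interior point of the parameter
set `Θ`, when the features have law `P`: `0 < g < 1` (so that the weight makes sense), two
continuous derivatives in the parameter near `θ₀`, with first derivative of `g` and of the
score dominated there by an integrable function, and finite second moments defining `A`. -/
structure IsRegularAt {f p : ℕ} (g : Feature f → Param p → ℝ) (Θ : Set (Param p))
    (θ₀ : Param p) (P : Measure (Feature f)) : Prop where
  measurable : Measurable (Function.uncurry g)
  mem_Ioo : ∀ᵐ t ∂P, ∀ θ ∈ Θ, g t θ ∈ Set.Ioo (0 : ℝ) 1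
  smooth : ∃ U : Set (Param p), IsOpen U ∧ θ₀ ∈ U ∧ U ⊆ Θ ∧
    (∀ᵐ t ∂P, ContDiffOn ℝ 2 (g t) U) ∧
    ∃ M : Feature f → ℝ, Integrable M P ∧
      ∀ᵐ t ∂P, ∀ θ ∈ U, ‖gradient (g t) θ‖ ≤ M t ∧
        ∀ y ∈ ({0, 1} : Set ℝ), ‖fderiv ℝ (score g t y) θ‖ ≤ M t
  integrable_weight : Integrable (fun t => weight g t θ₀ * ‖gradient (g t) θ₀‖ ^ 2) P

end PriorEstimation

end

namespace PriorEstimation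

/-! Write `Ψ_r` for the average of the score over the labeled pairs and `G_n` for the average of `g`
over all features. The law of a pair (feature, label) is a mixture of two copies of the feature law,
placed at label 1 with density `g` and at label 0 with density `1 - g`
(`map_pair_eq_add_withDensity`). Integrating against it shows that the score at the true parameter
is orthogonal to every square integrable function of the features, has second moment matrix `A`, and
has mean derivative `J = -A`.

A dominated oscillation of the derivatives and the weak law make `Ψ_r` and `G_n`, on a fixed small
ball, linear up to an arbitrarily small Lipschitz error `ε`, with probability tending to one
(`exists_tendsto_approximatesLinearOn_average`). A quantitative inverse function theorem then
produces a root of `Ψ_r` within `2K‖Ψ_r(θ₀)‖` of `θ₀`, where `K` bounds `J⁻¹`. Uniqueness of the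
root in `Θ` identifies it with the estimator, so existence and consistency are conclusions. On the
same event `G_n(θhat) - G_n(θ₀) + B J⁻¹ Ψ_r(θ₀)` is at most a constant times `ε ‖Ψ_r(θ₀)‖`. By
Chebyshev `‖Ψ_r(θ₀)‖` has order `n^(-1/2)`, and `ε` is arbitrary, so the remainder is
`o_P(n^(-1/2))` (`tendstoInMeasure_remainder`). Since `J = -A`, the linear term is exactly the
labeled-score term.

What remains is the limit law of `L_n + S_n`. After replacing `1/r` by `1/(γn)` this is a sum of two
independent blocks of i.i.d. variables, treated with characteristic functions (`clt_two_sample`).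
Orthogonality removes the cross term from the variance. -/

theorem tendsto_pow_exp_of_tendsto_mul_sub_one {φ : ℕ → ℂ} {k : ℕ → ℕ} {z : ℂ}
    (h1 : Tendsto φ atTop (𝓝 1))
    (h : Tendsto (fun n => (k n : ℂ) * (φ n - 1)) atTop (𝓝 z)) :
    Tendsto (fun n => φ n ^ k n) atTop (𝓝 (Complex.exp z)) := by
  have hd : DifferentiableAt ℂ Complex.log 1 :=
    (Complex.hasDerivAt_log (by simp)).differentiableAt
  -- `dslope` factors `log w` as `w - 1` times a function continuous at 1 with value 1, so no case
  -- `φ n = 1` has to be excluded.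
  have hds : Tendsto (fun n => dslope Complex.log 1 (φ n)) atTop (𝓝 1) := by
    have := (continuousAt_dslope_same.2 hd).tendsto.comp h1
    rwa [dslope_same, (Complex.hasDerivAt_log (by simp)).deriv, inv_one] at this
  have hlog : Tendsto (fun n => (k n : ℂ) * Complex.log (φ n)) atTop (𝓝 z) := by
    have := hds.mul h
    rw [one_mul] at this
    refine this.congr fun n => ?_
    have e := sub_smul_dslope Complex.log 1 (φ n)
    rw [Complex.log_one, sub_zero, smul_eq_mul] at e
    rw [← e]; ring
  refine ((Complex.continuous_exp.tendsto z).comp hlog).congr' ?_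
  filter_upwards [h1.eventually_ne one_ne_zero] with n hn
  rw [Function.comp_apply, Complex.exp_nat_mul, Complex.exp_log hn]

/-! ### Characteristic functions and a two-block central limit theorem -/

section CLT

variable {Ω : Type*} [MeasurableSpace Ω] {μ : Measure Ω}

theorem charFun_map_isLittleO [IsProbabilityMeasure μ] {X : Ω → ℝ} (hX : MemLp X 2 μ) (h0 : μ[X] = 0) :
    (fun t : ℝ => charFun (μ.map X) t - (1 - (μ[X ^ 2] : ℝ) * (t : ℂ) ^ 2 / 2))
      =o[𝓝 0] fun t : ℝ => t ^ 2 := by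
  have hm := hX.aestronglyMeasurable.aemeasurable
  have hid : MemLp id 2 (μ.map X) := by
    rw [memLp_map_measure_iff (by fun_prop) hm]; exact hX
  have := taylorWithinEval_charFun_two_zero hm hid
  have h2 : ∀ t : ℝ, (1 - (μ[X ^ 2] : ℝ) * (t : ℂ) ^ 2 / 2) =
    taylorWithinEval (charFun (μ.map X)) 2 Set.univ 0 t := by
    intro t; rw [this, h0]; simp
  have : IsProbabilityMeasure (μ.map X) := Measure.isProbabilityMeasure_map hm
  simp_rw [h2]
  convert! taylor_isLittleO_univ (contDiff_charFun hid) using 1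
  simp

/-- The exponent `k n` is kept apart from the scale `√n` so that the labeled and the unlabeled block
can share one normalization. The second-order Taylor expansion gives the limit of `n (φ - 1)`, and
`k n / n` contributes the factor `κ`. -/
theorem tendsto_charFun_pow [IsProbabilityMeasure μ] {X : Ω → ℝ} (hX : MemLp X 2 μ) (h0 : μ[X] = 0)
    {k : ℕ → ℕ} {κ : ℝ} (hk : Tendsto (fun n => (k n : ℝ) / n) atTop (𝓝 κ)) (t : ℝ) :
    Tendsto (fun n : ℕ => charFun (μ.map X) ((√n)⁻¹ * t) ^ k n) atTop
      (𝓝 (Complex.exp (-(κ * μ[X ^ 2] * t ^ 2 / 2 : ℝ)))) := by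
  have hm := hX.aestronglyMeasurable.aemeasurable
  have hpm : IsProbabilityMeasure (μ.map X) := Measure.isProbabilityMeasure_map hm
  have hs : Tendsto (fun n : ℕ => (√(n : ℝ))⁻¹ * t) atTop (𝓝 0) := by
    rw [← zero_mul t]
    exact .mul_const t (tendsto_inv_atTop_zero.comp <| Real.tendsto_sqrt_atTop.comp <|
      tendsto_natCast_atTop_atTop)
  have hc : Tendsto (fun n : ℕ => charFun (μ.map X) ((√n)⁻¹ * t)) atTop (𝓝 1) := by
    have := (continuous_charFun (μ := μ.map X)).tendsto 0 |>.comp hs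
    rw [charFun_zero, probReal_univ, Complex.ofReal_one] at this
    exact this
  refine tendsto_pow_exp_of_tendsto_mul_sub_one hc ?_
  have hO := (charFun_map_isLittleO hX h0).comp_tendsto hs
  set v : ℝ := μ[X ^ 2]
  set ρ : ℕ → ℂ := fun n => charFun (μ.map X) ((√n)⁻¹ * t) -
    (1 - (v : ℂ) * (((√n)⁻¹ * t : ℝ) : ℂ) ^ 2 / 2)
  have hρ : Tendsto (fun n : ℕ => (n : ℂ) * ρ n) atTop (𝓝 0) := by
    rw [tendsto_zero_iff_norm_tendsto_zero]
    have h3 : (fun n : ℕ => ρ n) =o[atTop] fun n : ℕ => ((n : ℝ)⁻¹) := by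
      refine hO.trans_isBigO (Asymptotics.isBigO_of_le' (c := t ^ 2) _ fun n => ?_)
      simp only [Function.comp_apply, mul_pow, inv_pow, Real.sq_sqrt (Nat.cast_nonneg n)]
      rw [norm_mul, mul_comm]; simp
    have h4 := (h3.norm_left).tendsto_div_nhds_zero
    refine h4.congr fun n => ?_
    rw [norm_mul, div_inv_eq_mul, mul_comm]; simp
  have hkc : Tendsto (fun n => (((k n : ℝ) / n : ℝ) : ℂ)) atTop (𝓝 (κ : ℂ)) :=
    (Complex.continuous_ofReal.tendsto κ).comp hk
  have hmain := (hkc.mul_const (-(v * t ^ 2 / 2 : ℂ))).add (hkc.mul hρ)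
  rw [mul_zero, add_zero] at hmain
  have e : (κ : ℂ) * (-(v * t ^ 2 / 2 : ℂ)) = -((κ * v * t ^ 2 / 2 : ℝ) : ℂ) := by
    push_cast; ring
  rw [e] at hmain
  refine hmain.congr' ?_
  filter_upwards [eventually_gt_atTop 0] with n hn
  have hn' : (n : ℂ) ≠ 0 := by exact_mod_cast hn.ne'
  have hsq : ((√(n : ℝ) : ℝ) : ℂ) ^ 2 = n := by
    rw [← Complex.ofReal_pow, Real.sq_sqrt (Nat.cast_nonneg n)]; simp
  simp only [ρ]
  push_cast
  rw [mul_pow, inv_pow, hsq]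
  field_simp
  ring

variable {E : Type*} [MeasurableSpace E] {Z : ℕ → Ω → E}

theorem charFun_map_two_sample (hindep : iIndepFun Z μ)
    (hident : ∀ i, IdentDistrib (Z i) (Z 0) μ μ) {a b : E → ℝ}
    (ha : AEMeasurable a (μ.map (Z 0))) (hb : AEMeasurable b (μ.map (Z 0)))
    {r n : ℕ} (hr : r ≤ n) (c t : ℝ) :
    charFun (μ.map fun ω => c * (∑ i ∈ Finset.range r, a (Z i ω)
        + ∑ i ∈ Finset.Ico r n, b (Z i ω))) t =
      charFun (μ.map (a ∘ Z 0)) (c * t) ^ r * charFun (μ.map (b ∘ Z 0)) (c * t) ^ (n - r) := by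
  have hmap : ∀ i, μ.map (Z i) = μ.map (Z 0) := fun i => (hident i).map_eq
  -- One index-dependent function turns both blocks into a single sum of independent variables.
  let F : ℕ → E → ℝ := fun i => if i < r then a else b
  have hF : ∀ i, AEMeasurable (F i) (μ.map (Z i)) := by
    intro i; rw [hmap]; simp only [F]; split_ifs <;> assumption
  have hFZ : iIndepFun (fun i => F i ∘ Z i) μ :=
    hindep.comp₀ F (fun i => (hident i).aemeasurable_fst) hF
  have hFm : ∀ i, AEMeasurable (F i ∘ Z i) μ := fun i =>
    (hF i).comp_aemeasurable (hident i).aemeasurable_fst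
  have hsum : (fun ω => c * (∑ i ∈ Finset.range r, a (Z i ω) + ∑ i ∈ Finset.Ico r n, b (Z i ω)))
      = fun ω => c * ∑ i ∈ Finset.range n, (F i ∘ Z i) ω := by
    funext ω
    rw [← Finset.sum_range_add_sum_Ico _ hr]
    congr 2 <;> refine Finset.sum_congr rfl fun i hi => ?_
    · simp [F, Finset.mem_range.1 hi]
    · simp [F, (Finset.mem_Ico.1 hi).1.not_gt]
  rw [hsum, charFun_map_mul_comp (Finset.aemeasurable_fun_sum _ fun i _ => hFm i),
    (hFZ.restrict _).charFun_map_fun_finsetSum_eq_prod (fun i _ => hFm i),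
    Finset.prod_apply, ← Finset.prod_range_mul_prod_Ico _ hr]
  have hid : ∀ (d : E → ℝ), AEMeasurable d (μ.map (Z 0)) → ∀ i,
      μ.map (d ∘ Z i) = μ.map (d ∘ Z 0) := fun d hd i =>
    ((hident i).comp_of_aemeasurable (by rwa [hmap])).map_eq
  congr 1
  · rw [Finset.prod_congr rfl (g := fun _ => charFun (μ.map (a ∘ Z 0)) (c * t))]
    · simp
    · intro i hi
      simp only [F, Finset.mem_range.1 hi, if_true, hid a ha i]
  · rw [Finset.prod_congr rfl (g := fun _ => charFun (μ.map (b ∘ Z 0)) (c * t))]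
    · simp
    · intro i hi
      simp only [F, (Finset.mem_Ico.1 hi).1.not_gt, if_false, hid b hb i]

/-- Lévy continuity: the characteristic function is a product of two powers with exponents `r` and
`n - r`, and the two Gaussian exponents add with weights `γ` and `1 - γ`. -/
theorem clt_two_sample [IsProbabilityMeasure μ] (hindep : iIndepFun Z μ)
    (hident : ∀ i, IdentDistrib (Z i) (Z 0) μ μ) {a b : E → ℝ}
    (ha : MemLp a 2 (μ.map (Z 0))) (hb : MemLp b 2 (μ.map (Z 0)))
    (ha0 : ∫ z, a z ∂(μ.map (Z 0)) = 0) (hb0 : ∫ z, b z ∂(μ.map (Z 0)) = 0)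
    {r : ℕ → ℕ} (hr : ∀ n, r n ≤ n) {γ : ℝ}
    (hrγ : Tendsto (fun n => (r n : ℝ) / (n : ℝ)) atTop (𝓝 γ)) {s : ℝ}
    (hs : s = γ * ∫ z, a z ^ 2 ∂(μ.map (Z 0)) + (1 - γ) * ∫ z, b z ^ 2 ∂(μ.map (Z 0)))
    (hs0 : 0 ≤ s) :
    TendstoInDistribution (fun (n : ℕ) ω => (√(n : ℝ))⁻¹ *
      (∑ i ∈ Finset.range (r n), a (Z i ω) + ∑ i ∈ Finset.Ico (r n) n, b (Z i ω)))
      atTop (id : ℝ → ℝ) (fun _ => μ) (gaussianReal 0 s.toNNReal) := by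
  have hZ := fun i => (hident i).aemeasurable_fst
  have hcomp : ∀ {d : E → ℝ}, AEMeasurable d (μ.map (Z 0)) → ∀ i, AEMeasurable (fun ω => d (Z i ω)) μ :=
    fun hd i => (show AEMeasurable _ _ by rwa [(hident i).map_eq]).comp_aemeasurable (hZ i)
  have ham := ha.aestronglyMeasurable.aemeasurable
  have hbm := hb.aestronglyMeasurable.aemeasurable
  have h1r : Tendsto (fun n => ((n - r n : ℕ) : ℝ) / (n : ℝ)) atTop (𝓝 (1 - γ)) := by
    refine (hrγ.const_sub 1).congr' ?_
    filter_upwards [eventually_gt_atTop 0] with n hn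
    have : (n : ℝ) ≠ 0 := by exact_mod_cast hn.ne'
    rw [Nat.cast_sub (hr n)]; field_simp
  have hsq : ∀ {d : E → ℝ}, MemLp d 2 (μ.map (Z 0)) → ∫ z, d z ∂(μ.map (Z 0)) = 0 →
      MemLp (d ∘ Z 0) 2 μ ∧ μ[d ∘ Z 0] = 0 ∧ μ[(d ∘ Z 0) ^ 2] = ∫ z, d z ^ 2 ∂(μ.map (Z 0)) := by
    intro d hd hd0
    refine ⟨hd.comp_of_map (hZ 0), ?_, ?_⟩
    · rw [integral_map (hZ 0) hd.aestronglyMeasurable] at hd0; exact hd0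
    · exact (integral_map (hZ 0) (hd.aestronglyMeasurable.pow 2)).symm
  refine ⟨fun n => ?_, by fun_prop, ?_⟩
  · exact ((Finset.aemeasurable_fun_sum _ fun i _ => hcomp ham i).add
      (Finset.aemeasurable_fun_sum _ fun i _ => hcomp hbm i)).const_mul _
  · refine ProbabilityMeasure.tendsto_iff_tendsto_charFun.2 fun t => ?_
    simp only [ProbabilityMeasure.coe_mk]
    rw [Measure.map_id, charFun_gaussianReal]
    simp_rw [charFun_map_two_sample hindep hident ham hbm (hr _)]
    obtain ⟨a1, a2, a3⟩ := hsq ha ha0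
    obtain ⟨b1, b2, b3⟩ := hsq hb hb0
    have := (tendsto_charFun_pow a1 a2 hrγ t).mul (tendsto_charFun_pow b1 b2 h1r t)
    rw [← Complex.exp_add, a3, b3] at this
    convert this using 3
    rw [Real.coe_toNNReal _ hs0, hs]
    push_cast
    ring

end CLT

end PriorEstimation

namespace PriorEstimation

/-! ### Measurability of derivatives with respect to the data -/

section Measurability

variable {S V W : Type*} [MeasurableSpace S] {Q : Measure S}
  [NormedAddCommGroup V] [NormedSpace ℝ V]
  [NormedAddCommGroup W] [NormedSpace ℝ W]

theorem aestronglyMeasurable_fderiv_apply {F : S → V → W} {U : Set V} (hU : IsOpen U) {θ : V}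
    (hθ : θ ∈ U) (hF : ∀ ϑ ∈ U, AEStronglyMeasurable (fun z => F z ϑ) Q)
    (hd : ∀ᵐ z ∂Q, DifferentiableAt ℝ (F z) θ) (v : V) :
    AEStronglyMeasurable (fun z => fderiv ℝ (F z) θ v) Q := by
  have hlim : Tendsto (fun n : ℕ => θ + ((n : ℝ))⁻¹ • v) atTop (𝓝 θ) := by
    have : Tendsto (fun n : ℕ => θ + ((n : ℝ))⁻¹ • v) atTop (𝓝 (θ + (0 : ℝ) • v)) :=
      (tendsto_inv_atTop_nhds_zero_nat.smul_const v).const_add θ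
    simpa using this
  -- The derivative is an a.e. limit of difference quotients. These are known to be measurable only
  -- while `θ + n⁻¹ • v` stays in `U`, hence the shift of the sequence by `N`.
  obtain ⟨N, hN⟩ := eventually_atTop.1 (hlim.eventually (hU.mem_nhds hθ))
  refine aestronglyMeasurable_of_tendsto_ae atTop
    (f := fun (n : ℕ) z => (((n + N : ℕ)) : ℝ) • (F z (θ + (((n + N : ℕ)) : ℝ)⁻¹ • v) - F z θ))
    (fun n => ((hF _ (hN _ (Nat.le_add_left N n))).sub (hF θ hθ)).const_smul _) ?_
  filter_upwards [hd] with z hz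
  refine (hz.hasFDerivAt.lim (c := fun n : ℕ => (n : ℝ)) v ?_).comp (tendsto_add_atTop_nat N)
  simpa using tendsto_natCast_atTop_atTop (R := ℝ)

variable [FiniteDimensional ℝ V]

/-- In a basis of the finite-dimensional domain, `D z` is a finite sum of continuous images of the
vectors `D z (b i)`. -/
theorem aestronglyMeasurable_clm {D : S → V →L[ℝ] W}
    (hD : ∀ v, AEStronglyMeasurable (fun z => D z v) Q) : AEStronglyMeasurable D Q := by
  let b := Module.finBasis ℝ V
  have e : D = fun z => ∑ i,
      ContinuousLinearMap.smulRightL ℝ V W (LinearMap.toContinuousLinearMap (b.coord i))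
        (D z (b i)) := by
    funext z
    ext v
    simp only [sum_apply, ContinuousLinearMap.smulRightL_apply_apply,
      LinearMap.coe_toContinuousLinearMap', ContinuousLinearMap.smulRight_apply, ← map_smul,
      ← map_sum]
    congr 1
    exact (b.sum_repr v).symm
  rw [e]
  exact Finset.aestronglyMeasurable_fun_sum _ fun i _ =>
    (ContinuousLinearMap.continuous _).comp_aestronglyMeasurable (hD _)

theorem aestronglyMeasurable_fderiv {F : S → V → W} {U : Set V} (hU : IsOpen U) {θ : V}
    (hθ : θ ∈ U) (hF : ∀ ϑ ∈ U, AEStronglyMeasurable (fun z => F z ϑ) Q)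
    (hd : ∀ᵐ z ∂Q, DifferentiableAt ℝ (F z) θ) :
    AEStronglyMeasurable (fun z => fderiv ℝ (F z) θ) Q :=
  aestronglyMeasurable_clm fun v => aestronglyMeasurable_fderiv_apply hU hθ hF hd v

end Measurability

/-! ### Weak law of large numbers -/

section LLN

variable {Ω : Type*} [MeasurableSpace Ω] {μ : Measure Ω} [IsProbabilityMeasure μ]
  {S : Type*} [MeasurableSpace S] {Z : ℕ → Ω → S}

theorem tendsto_measure_average_sub {E : Type*} [NormedAddCommGroup E] [NormedSpace ℝ E]
    [CompleteSpace E] (hindep : iIndepFun Z μ) (hident : ∀ i, IdentDistrib (Z i) (Z 0) μ μ)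
    {F : S → E} (hF : Integrable F (μ.map (Z 0))) {ε : ℝ} (hε : 0 < ε) :
    Tendsto (fun n : ℕ => μ {ω | ε ≤ ‖(n : ℝ)⁻¹ • ∑ i ∈ Finset.range n, F (Z i ω)
      - ∫ z, F z ∂(μ.map (Z 0))‖}) atTop (𝓝 0) := by
  -- The law is also applied to operator-valued derivatives, so the value space carries no σ-algebra
  -- in the statement.
  let _ : MeasurableSpace E := borel _
  have : BorelSpace E := ⟨rfl⟩
  have hZ := fun i => (hident i).aemeasurable_fst
  have hmap : ∀ i, μ.map (Z i) = μ.map (Z 0) := fun i => (hident i).map_eq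
  have hFi : ∀ i, AEMeasurable F (μ.map (Z i)) := fun i => by
    rw [hmap]; exact hF.aestronglyMeasurable.aemeasurable
  have hFm : ∀ i, AEStronglyMeasurable (F ∘ Z i) μ := fun i =>
    AEStronglyMeasurable.comp_aemeasurable (by rw [hmap]; exact hF.aestronglyMeasurable) (hZ i)
  rw [integral_map (hZ 0) hF.aestronglyMeasurable]
  refine tendstoInMeasure_iff_norm.1 (tendstoInMeasure_of_tendsto_ae
    (f := fun (n : ℕ) ω => (n : ℝ)⁻¹ • ∑ i ∈ Finset.range n, F (Z i ω))
    (g := fun _ => ∫ ω, F (Z 0 ω) ∂μ)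
    (fun n => (Finset.aestronglyMeasurable_fun_sum _ fun i _ => hFm i).const_smul _) ?_) ε hε
  refine strong_law_ae (fun i => F ∘ Z i) (hF.comp_aemeasurable (hZ 0)) ?_ fun i =>
    (hident i).comp_of_aemeasurable (hFi i)
  intro i j hij
  exact (hindep.comp₀ (fun _ => F) hZ hFi).indepFun hij

end LLN

/-! ### Oscillation of the derivative and approximate linearity of averages -/

section Modulus

variable {S V W : Type*} [NormedAddCommGroup V] [NormedSpace ℝ V] [FiniteDimensional ℝ V]
  [NormedAddCommGroup W] [NormedSpace ℝ W]

open Classical in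
/-- The oscillation of the derivative of `F z` around `θ`, as a supremum over a countable dense
subset of the ball of radius `δ`. -/
noncomputable def derivOsc (F : S → V → W) (θ : V) (δ : ℝ) (z : S) : ℝ :=
  haveI : ProperSpace V := FiniteDimensional.proper_real V
  ⨆ k : ℕ, if TopologicalSpace.denseSeq V k ∈ Metric.ball θ δ then
    ‖fderiv ℝ (F z) (TopologicalSpace.denseSeq V k) - fderiv ℝ (F z) θ‖ else 0

variable {F : S → V → W} {θ : V} {δ : ℝ} {z : S}

theorem derivOsc_nonneg : 0 ≤ derivOsc F θ δ z :=
  Real.iSup_nonneg fun k => by split_ifs <;> positivity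

theorem derivOsc_le {C : ℝ} (hC : 0 ≤ C)
    (h : ∀ ϑ ∈ Metric.ball θ δ, ‖fderiv ℝ (F z) ϑ - fderiv ℝ (F z) θ‖ ≤ C) :
    derivOsc F θ δ z ≤ C :=
  Real.iSup_le (fun k => by split_ifs with hk; exacts [h _ hk, hC]) hC

/-- Density and continuity carry the bound from the dense sequence to the whole ball. The constant
`C` ensures that the supremum is a genuine one, as an unbounded real supremum defaults to 0. -/
theorem norm_fderiv_sub_le_derivOsc {C : ℝ}
    (hC : ∀ ϑ ∈ Metric.ball θ δ, ‖fderiv ℝ (F z) ϑ - fderiv ℝ (F z) θ‖ ≤ C)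
    (hc : ContinuousOn (fderiv ℝ (F z)) (Metric.ball θ δ)) {ϑ : V} (hϑ : ϑ ∈ Metric.ball θ δ) :
    ‖fderiv ℝ (F z) ϑ - fderiv ℝ (F z) θ‖ ≤ derivOsc F θ δ z := by
  have : ProperSpace V := FiniteDimensional.proper_real V
  have hbdd : BddAbove (Set.range fun k : ℕ => @ite ℝ
      (TopologicalSpace.denseSeq V k ∈ Metric.ball θ δ) (Classical.propDecidable _)
      ‖fderiv ℝ (F z) (TopologicalSpace.denseSeq V k) - fderiv ℝ (F z) θ‖ 0) := by
    refine ⟨max C 0, ?_⟩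
    rintro _ ⟨k, rfl⟩
    dsimp only
    split_ifs with hk
    exacts [(hC _ hk).trans (le_max_left _ _), le_max_right _ _]
  have hcl : ϑ ∈ closure (Metric.ball θ δ ∩ Set.range (TopologicalSpace.denseSeq V)) :=
    (TopologicalSpace.denseRange_denseSeq V).open_subset_closure_inter Metric.isOpen_ball hϑ
  have hca : ContinuousAt (fun ϑ => ‖fderiv ℝ (F z) ϑ - fderiv ℝ (F z) θ‖) ϑ :=
    ((hc.continuousAt (Metric.isOpen_ball.mem_nhds hϑ)).sub continuousAt_const).norm
  have := mem_closure_iff_nhdsWithin_neBot.1 hcl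
  refine le_of_tendsto (hca.tendsto.mono_left (nhdsWithin_le_nhds (s := Metric.ball θ δ ∩
    Set.range (TopologicalSpace.denseSeq V)))) ?_
  filter_upwards [self_mem_nhdsWithin] with x hx
  obtain ⟨hxb, k, rfl⟩ := hx
  have := le_ciSup hbdd k
  rwa [if_pos hxb] at this

theorem aemeasurable_derivOsc [MeasurableSpace S] {Q : Measure S} {U : Set V} (hU : IsOpen U) (hθ : θ ∈ U)
    (hF : ∀ ϑ ∈ U, AEStronglyMeasurable (fun z => F z ϑ) Q)
    (hd : ∀ᵐ z ∂Q, ∀ ϑ ∈ U, DifferentiableAt ℝ (F z) ϑ) (hδ : Metric.ball θ δ ⊆ U) :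
    AEMeasurable (derivOsc F θ δ) Q := by
  refine AEMeasurable.iSup fun k => ?_
  split_ifs with hk
  · have h := fun (ϑ : V) (h : ϑ ∈ U) => aestronglyMeasurable_fderiv hU h hF
      (hd.mono fun z hz => hz ϑ h)
    exact ((h _ (hδ hk)).sub (h _ hθ)).norm.aemeasurable
  · exact aemeasurable_const

/-- Dominated convergence along shrinking radii: the oscillation tends to 0 pointwise by continuity
of the derivative, and it is at most `2 * M`. -/
theorem exists_integral_derivOsc_lt [MeasurableSpace S] {Q : Measure S} {U : Set V} (hU : IsOpen U) (hθ : θ ∈ U)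
    (hF : ∀ ϑ ∈ U, AEStronglyMeasurable (fun z => F z ϑ) Q)
    (hC1 : ∀ᵐ z ∂Q, ContDiffOn ℝ 1 (F z) U) {M : S → ℝ} (hM : Integrable M Q)
    (hb : ∀ᵐ z ∂Q, ∀ ϑ ∈ U, ‖fderiv ℝ (F z) ϑ‖ ≤ M z) {ε : ℝ} (hε : 0 < ε) :
    ∃ δ > 0, Metric.ball θ δ ⊆ U ∧ Integrable (derivOsc F θ δ) Q ∧
      ∫ z, derivOsc F θ δ z ∂Q < ε := by
  obtain ⟨ρ, hρ, hρU⟩ := Metric.isOpen_iff.1 hU θ hθ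
  have hd : ∀ᵐ z ∂Q, ∀ ϑ ∈ U, DifferentiableAt ℝ (F z) ϑ := by
    filter_upwards [hC1] with z hz ϑ hϑ
    exact (hz.differentiableOn one_ne_zero).differentiableAt (hU.mem_nhds hϑ)
  let δ : ℕ → ℝ := fun n => ρ / (n + 1)
  have hδ0 : ∀ n, 0 < δ n := fun n => by positivity
  have hδU : ∀ n, Metric.ball θ (δ n) ⊆ U := fun n =>
    (Metric.ball_subset_ball (div_le_self hρ.le (by simp))).trans hρU
  have hm : ∀ n, AEStronglyMeasurable (derivOsc F θ (δ n)) Q := fun n =>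
    (aemeasurable_derivOsc hU hθ hF hd (hδU n)).aestronglyMeasurable
  have hle : ∀ n, ∀ᵐ z ∂Q, ‖derivOsc F θ (δ n) z‖ ≤ 2 * M z := by
    intro n
    filter_upwards [hb] with z hz
    have h0 : 0 ≤ M z := (norm_nonneg _).trans (hz θ hθ)
    rw [Real.norm_of_nonneg derivOsc_nonneg]
    refine derivOsc_le (by positivity) fun ϑ hϑ => (norm_sub_le _ _).trans ?_
    linarith [hz θ hθ, hz ϑ (hδU n hϑ)]
  have hδlim : Tendsto δ atTop (𝓝 0) :=
    tendsto_const_nhds.div_atTop (tendsto_natCast_atTop_atTop.atTop_add tendsto_const_nhds)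
  have hlim : ∀ᵐ z ∂Q, Tendsto (fun n => derivOsc F θ (δ n) z) atTop (𝓝 0) := by
    filter_upwards [hC1] with z hz
    have hcont : ContinuousAt (fderiv ℝ (F z)) θ :=
      (hz.continuousOn_fderiv_of_isOpen hU le_rfl).continuousAt (hU.mem_nhds hθ)
    rw [Metric.tendsto_atTop']
    intro e he
    obtain ⟨η, hη, hηe⟩ := Metric.continuousAt_iff.1 hcont (e / 2) (by positivity)
    obtain ⟨N, hN⟩ := eventually_atTop.1 (hδlim.eventually (gt_mem_nhds hη))
    refine ⟨N, fun n hn => ?_⟩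
    rw [Real.dist_0_eq_abs, abs_of_nonneg derivOsc_nonneg]
    refine (derivOsc_le (C := e / 2) (by positivity) fun ϑ hϑ => ?_).trans_lt (by linarith)
    rw [← dist_eq_norm]
    exact (hηe (lt_trans (Metric.mem_ball.1 hϑ) (hN n hn.le))).le
  have hint := tendsto_integral_of_dominated_convergence (fun z => 2 * M z) hm (hM.const_mul 2) hle
    hlim
  rw [integral_zero] at hint
  obtain ⟨n, hn⟩ := (hint.eventually (gt_mem_nhds hε)).exists
  exact ⟨δ n, hδ0 n, hδU n, (hM.const_mul 2).mono' (hm n) (hle n), hn⟩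

open scoped NNReal in
-- The deterministic half of the uniform law: the mean value inequality bounds each summand's
-- deviation from its derivative at `θ` by its oscillation, and averaging adds the distance of the
-- mean derivative from `J`.
theorem approximatesLinearOn_average_of_derivOsc {U : Set V} (hU : IsOpen U) {s : Set V}
    (hs : s ⊆ Metric.ball θ δ) (hδU : Metric.ball θ δ ⊆ U) (hθ : θ ∈ U) {n : ℕ} {z : ℕ → S}
    {M : S → ℝ} (hC1 : ∀ i, ContDiffOn ℝ 1 (F (z i)) U)
    (hb : ∀ i, ∀ ϑ ∈ U, ‖fderiv ℝ (F (z i)) ϑ‖ ≤ M (z i)) {J : V →L[ℝ] W} {ε : ℝ≥0} {c₁ c₂ : ℝ}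
    (h1 : (n : ℝ)⁻¹ • ∑ i ∈ Finset.range n, derivOsc F θ δ (z i) ≤ c₁)
    (h2 : ‖(n : ℝ)⁻¹ • ∑ i ∈ Finset.range n, fderiv ℝ (F (z i)) θ - J‖ ≤ c₂)
    (hc : c₁ + c₂ ≤ ε) :
    ApproximatesLinearOn (fun ϑ => (n : ℝ)⁻¹ • ∑ i ∈ Finset.range n, F (z i) ϑ) J s ε := by
  intro x hx y hy
  have hi : ∀ i, ‖F (z i) x - F (z i) y - fderiv ℝ (F (z i)) θ (x - y)‖ ≤
      derivOsc F θ δ (z i) * ‖x - y‖ := by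
    intro i
    refine (convex_ball θ δ).norm_image_sub_le_of_norm_fderiv_le' (𝕜 := ℝ) (fun w hw => ?_)
      (fun w hw => ?_) (hs hy) (hs hx)
    · exact ((hC1 i).differentiableOn one_ne_zero).differentiableAt (hU.mem_nhds (hδU hw))
    · refine norm_fderiv_sub_le_derivOsc (C := 2 * M (z i)) (fun v hv => ?_)
        (((hC1 i).continuousOn_fderiv_of_isOpen hU le_rfl).mono hδU) hw
      refine (norm_sub_le _ _).trans ?_
      linarith [hb i θ hθ, hb i v (hδU hv)]
  have e : (n : ℝ)⁻¹ • ∑ i ∈ Finset.range n, F (z i) x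
      - (n : ℝ)⁻¹ • ∑ i ∈ Finset.range n, F (z i) y - J (x - y) = (n : ℝ)⁻¹ •
      ∑ i ∈ Finset.range n, (F (z i) x - F (z i) y - fderiv ℝ (F (z i)) θ (x - y))
      + ((n : ℝ)⁻¹ • ∑ i ∈ Finset.range n, fderiv ℝ (F (z i)) θ - J) (x - y) := by
    rw [sub_apply, smul_apply, sum_apply,
      Finset.sum_sub_distrib, Finset.sum_sub_distrib, smul_sub, smul_sub]
    abel
  have hA := ContinuousLinearMap.le_of_opNorm_le _ h2 (x - y)
  have hB : ‖(n : ℝ)⁻¹ • ∑ i ∈ Finset.range n,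
      (F (z i) x - F (z i) y - fderiv ℝ (F (z i)) θ (x - y))‖ ≤ c₁ * ‖x - y‖ := by
    refine le_trans ?_ (mul_le_mul_of_nonneg_right h1 (norm_nonneg _))
    rw [norm_smul, Real.norm_of_nonneg (by positivity), smul_eq_mul, mul_assoc, Finset.sum_mul]
    gcongr
    exact (norm_sum_le _ _).trans (Finset.sum_le_sum fun i _ => hi i)
  show ‖(n : ℝ)⁻¹ • ∑ i ∈ Finset.range n, F (z i) x
      - (n : ℝ)⁻¹ • ∑ i ∈ Finset.range n, F (z i) y - J (x - y)‖ ≤ _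
  rw [e]
  refine (norm_add_le _ _).trans ((add_le_add hB hA).trans ?_)
  rw [← add_mul]
  exact mul_le_mul_of_nonneg_right hc (norm_nonneg _)

end Modulus

/-! ### Uniform linearization with high probability -/

section ULLN

variable {Ω : Type*} [MeasurableSpace Ω] {μ : Measure Ω} [IsProbabilityMeasure μ]
  {S : Type*} [MeasurableSpace S] {Z : ℕ → Ω → S}
  {V W : Type*} [NormedAddCommGroup V] [NormedSpace ℝ V] [FiniteDimensional ℝ V]
  [NormedAddCommGroup W] [NormedSpace ℝ W] [CompleteSpace W]

open scoped NNReal in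
-- Uniformity over the ball costs only two pointwise weak laws. If the mean oscillation is below
-- `ε/2`, then with high probability its average is below `3ε/4` and the average derivative is
-- within `ε/4` of its mean.
theorem exists_tendsto_approximatesLinearOn_average (hindep : iIndepFun Z μ)
    (hident : ∀ i, IdentDistrib (Z i) (Z 0) μ μ) {F : S → V → W} {U : Set V} (hU : IsOpen U)
    {θ : V} (hθ : θ ∈ U)
    (hF : ∀ ϑ ∈ U, AEStronglyMeasurable (fun z => F z ϑ) (μ.map (Z 0)))
    (hC1 : ∀ᵐ z ∂(μ.map (Z 0)), ContDiffOn ℝ 1 (F z) U) {M : S → ℝ}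
    (hM : Integrable M (μ.map (Z 0)))
    (hb : ∀ᵐ z ∂(μ.map (Z 0)), ∀ ϑ ∈ U, ‖fderiv ℝ (F z) ϑ‖ ≤ M z) {ε : ℝ≥0} (hε : 0 < ε) :
    ∃ δ > 0, Metric.closedBall θ δ ⊆ U ∧ Tendsto (fun n : ℕ => μ {ω | ¬ ApproximatesLinearOn
      (fun ϑ => (n : ℝ)⁻¹ • ∑ i ∈ Finset.range n, F (Z i ω) ϑ)
      (∫ z, fderiv ℝ (F z) θ ∂(μ.map (Z 0))) (Metric.closedBall θ δ) ε}) atTop (𝓝 0) := by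
  have hε' : (0 : ℝ) < ε := hε
  obtain ⟨δ, hδ, hδU, hosc, hlt⟩ := exists_integral_derivOsc_lt (ε := ε / 2) hU hθ hF hC1 hM hb
    (by positivity)
  have hsub : Metric.closedBall θ (δ / 2) ⊆ Metric.ball θ δ :=
    Metric.closedBall_subset_ball (by linarith)
  refine ⟨δ / 2, by positivity, hsub.trans hδU, ?_⟩
  have hd : ∀ᵐ z ∂(μ.map (Z 0)), DifferentiableAt ℝ (F z) θ := by
    filter_upwards [hC1] with z hz
    exact (hz.differentiableOn one_ne_zero).differentiableAt (hU.mem_nhds hθ)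
  have hD : Integrable (fun z => fderiv ℝ (F z) θ) (μ.map (Z 0)) :=
    hM.mono' (aestronglyMeasurable_fderiv hU hθ hF hd) (hb.mono fun z hz => hz θ hθ)
  have h1 : Tendsto (fun n : ℕ => μ {ω | (ε / 4 : ℝ) ≤ ‖(n : ℝ)⁻¹ • ∑ i ∈ Finset.range n,
      derivOsc F θ δ (Z i ω) - ∫ z, derivOsc F θ δ z ∂(μ.map (Z 0))‖}) atTop (𝓝 0) :=
    tendsto_measure_average_sub hindep hident hosc (by positivity)
  have h2 : Tendsto (fun n : ℕ => μ {ω | (ε / 4 : ℝ) ≤ ‖(n : ℝ)⁻¹ • ∑ i ∈ Finset.range n,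
      fderiv ℝ (F (Z i ω)) θ - ∫ z, fderiv ℝ (F z) θ ∂(μ.map (Z 0))‖}) atTop (𝓝 0) :=
    tendsto_measure_average_sub hindep hident hD (by positivity)
  have h12 := h1.add h2
  rw [add_zero] at h12
  refine tendsto_of_tendsto_of_tendsto_of_le_of_le tendsto_const_nhds h12 (fun _ => zero_le)
    fun n => ?_
  refine (measure_mono_ae ?_).trans (measure_union_le _ _)
  have hgood : ∀ᵐ ω ∂μ, ∀ i, ContDiffOn ℝ 1 (F (Z i ω)) U ∧
      ∀ ϑ ∈ U, ‖fderiv ℝ (F (Z i ω)) ϑ‖ ≤ M (Z i ω) := by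
    rw [ae_all_iff]
    intro i
    have hi := hC1.and hb
    rw [← (hident i).map_eq] at hi
    exact ae_of_ae_map (hident i).aemeasurable_fst hi
  filter_upwards [hgood] with ω hω hn
  by_contra hcon
  have c1 := fun h => hcon (Set.mem_union_left _ h)
  have c2 := fun h => hcon (Set.mem_union_right _ h)
  simp only [Set.mem_ofPred_eq, imp_false, not_le] at c1 c2
  refine hn (approximatesLinearOn_average_of_derivOsc (c₁ := 3 * ε / 4) (c₂ := ε / 4) hU hsub hδU
    hθ (fun i => (hω i).1) (fun i => (hω i).2) ?_ c2.le (by linarith))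
  have := (abs_lt.1 (Real.norm_eq_abs _ ▸ c1)).2
  linarith

end ULLN

end PriorEstimation

namespace PriorEstimation

/-! ### Roots and first-order expansion of nearly linear maps -/

section Expansion

open scoped NNReal

variable {V : Type*} [NormedAddCommGroup V] [NormedSpace ℝ V] {Ψ : V → V} {J : V ≃L[ℝ] V}
  {θ : V} {s : Set V} {ε : ℝ≥0} {K : ℝ}

/-- The image of the ball of radius `2K‖Ψ θ‖` contains the ball about `Ψ θ` of radius `(K⁻¹ - ε)
2K‖Ψ θ‖ = 2(1 - εK)‖Ψ θ‖`. This is at least `‖Ψ θ‖`, so 0 is attained. -/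
theorem exists_root_of_approximatesLinearOn [CompleteSpace V]
    (hΨ : ApproximatesLinearOn Ψ (J : V →L[ℝ] V) s ε) (hK : 0 < K)
    (hJ : ∀ v, ‖J.symm v‖ ≤ K * ‖v‖) (hεK : ε * K ≤ 1 / 2)
    (hs : Metric.closedBall θ (2 * K * ‖Ψ θ‖) ⊆ s) :
    ∃ ϑ ∈ Metric.closedBall θ (2 * K * ‖Ψ θ‖), Ψ ϑ = 0 := by
  let R : (J : V →L[ℝ] V).NonlinearRightInverse :=
    { toFun := J.symm
      nnnorm := ⟨K, hK.le⟩
      bound' := hJ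
      right_inv' := fun y => J.apply_symm_apply y }
  have hsurj := hΨ.surjOn_closedBall_of_nonlinearRightInverse R
    (ε := 2 * K * ‖Ψ θ‖) (b := θ) (by positivity) hs
  refine hsurj ?_
  rw [Metric.mem_closedBall, dist_zero_left]
  have hR : ((R.nnnorm : ℝ≥0) : ℝ) = K := rfl
  rw [hR]
  have : (K⁻¹ - ε) * (2 * K * ‖Ψ θ‖) = 2 * (1 - ε * K) * ‖Ψ θ‖ := by field_simp
  rw [this]
  nlinarith [norm_nonneg (Ψ θ)]

/-- Solving the linearized equation for `ϑ - θ` and inserting it in the linearization of `G` leaves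
two errors, each proportional to `ε ‖ϑ - θ‖`. -/
theorem abs_sub_add_le_of_approximatesLinearOn {G : V → ℝ} {B : V →L[ℝ] ℝ}
    (hΨ : ApproximatesLinearOn Ψ (J : V →L[ℝ] V) s ε) (hG : ApproximatesLinearOn G B s ε)
    (hK : 0 < K) (hJ : ∀ v, ‖J.symm v‖ ≤ K * ‖v‖) {ϑ : V} (hθ : θ ∈ s) (hϑ : ϑ ∈ s)
    (hroot : Ψ ϑ = 0) (hle : ‖ϑ - θ‖ ≤ 2 * K * ‖Ψ θ‖) :
    |G ϑ - G θ + B (J.symm (Ψ θ))| ≤ ε * (2 * K * (1 + ‖B‖ * K)) * ‖Ψ θ‖ := by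
  have h1 := hG ϑ hϑ θ hθ
  have h2 := hΨ ϑ hϑ θ hθ
  rw [hroot, zero_sub] at h2
  set e := -Ψ θ - (J : V →L[ℝ] V) (ϑ - θ) with he
  have h3 : J.symm (Ψ θ) = -(ϑ - θ) - J.symm e := by
    rw [he, map_sub, map_neg]
    simp only [ContinuousLinearEquiv.coe_coe, J.symm_apply_apply]
    abel
  have h4 : G ϑ - G θ + B (J.symm (Ψ θ)) = (G ϑ - G θ - B (ϑ - θ)) - B (J.symm e) := by
    rw [h3, map_sub, map_neg]; ring
  have h5 : ‖B (J.symm e)‖ ≤ ‖B‖ * (K * (ε * ‖ϑ - θ‖)) := by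
    refine (B.le_opNorm _).trans ?_
    gcongr
    exact (hJ e).trans (by gcongr)
  rw [h4, ← Real.norm_eq_abs]
  refine (norm_sub_le _ _).trans ((add_le_add h1 h5).trans ?_)
  calc ε * ‖ϑ - θ‖ + ‖B‖ * (K * (ε * ‖ϑ - θ‖)) = ε * (1 + ‖B‖ * K) * ‖ϑ - θ‖ := by ring
    _ ≤ ε * (1 + ‖B‖ * K) * (2 * K * ‖Ψ θ‖) := by gcongr
    _ = _ := by ring

end Expansion

/-! ### The joint law of features and a binary label -/

section BinaryResponse

variable {Ω : Type*} [mΩ : MeasurableSpace Ω] {μ : Measure Ω} [IsProbabilityMeasure μ]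
  {S : Type*} [mS : MeasurableSpace S] {X : Ω → S} {y : Ω → ℝ} {π : S → ℝ}

theorem measureReal_inter_preimage_eq (hX : Measurable X) (hy : Measurable y)
    (hπ : Measurable π)
    (hmodel : μ⟦{ω | y ω = 1} | MeasurableSpace.comap X inferInstance⟧ =ᵐ[μ] fun ω => π (X ω))
    {s : Set S} (hs : MeasurableSet s) :
    μ.real ({ω | y ω = 1} ∩ X ⁻¹' s) = ∫ t in s, π t ∂(μ.map X) := by
  have hy1 : MeasurableSet {ω | y ω = 1} := hy (measurableSet_singleton 1)
  have h1 := setIntegral_condExp (μ := μ) (m := MeasurableSpace.comap X inferInstance)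
    (f := Set.indicator {ω | y ω = 1} fun _ => (1 : ℝ)) hX.comap_le
    ((integrable_const 1).indicator hy1) (s := X ⁻¹' s) ⟨s, hs, rfl⟩
  rw [setIntegral_map hs hπ.aestronglyMeasurable hX.aemeasurable,
    ← setIntegral_congr_ae (hX hs) (hmodel.mono fun ω h _ => h), h1,
    integral_indicator hy1, Measure.restrict_restrict hy1, setIntegral_const]
  simp

/-- This turns the conditional probability model into an explicit measure: expectations become
integrals over the features, and a.e. properties need checking only at labels 1 and 0. -/
theorem map_pair_eq_add_withDensity (hX : Measurable X) (hy : Measurable y)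
    (hy01 : ∀ ω, y ω = 0 ∨ y ω = 1) (hπ : Measurable π)
    (hπ01 : ∀ᵐ t ∂(μ.map X), π t ∈ Set.Icc (0 : ℝ) 1)
    (hmodel : μ⟦{ω | y ω = 1} | MeasurableSpace.comap X inferInstance⟧ =ᵐ[μ] fun ω => π (X ω)) :
    μ.map (fun ω => (X ω, y ω)) =
      ((μ.map X).withDensity fun t => ENNReal.ofReal (π t)).map (fun t => (t, (1 : ℝ))) +
      ((μ.map X).withDensity fun t => ENNReal.ofReal (1 - π t)).map (fun t => (t, (0 : ℝ))) := by
  have hP : IsProbabilityMeasure (μ.map X) := Measure.isProbabilityMeasure_map hX.aemeasurable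
  have hint : Integrable π (μ.map X) := by
    refine Integrable.of_bound hπ.aestronglyMeasurable 1 (hπ01.mono fun t ht => ?_)
    rw [Real.norm_of_nonneg ht.1]; exact ht.2
  have hint' : Integrable (fun t => 1 - π t) (μ.map X) := (integrable_const 1).sub hint
  have hy1 : MeasurableSet {ω | y ω = 1} := hy (measurableSet_singleton 1)
  ext s hs
  have hm1 : Measurable fun t : S => (t, (1 : ℝ)) := by fun_prop
  have hm0 : Measurable fun t : S => (t, (0 : ℝ)) := by fun_prop
  set s1 := (fun t : S => (t, (1 : ℝ))) ⁻¹' s with hs1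
  set s0 := (fun t : S => (t, (0 : ℝ))) ⁻¹' s with hs0
  have ms1 : MeasurableSet s1 := hm1 hs
  have ms0 : MeasurableSet s0 := hm0 hs
  have hset : (fun ω => (X ω, y ω)) ⁻¹' s =
      ({ω | y ω = 1} ∩ X ⁻¹' s1) ∪ (X ⁻¹' s0 \ ({ω | y ω = 1} ∩ X ⁻¹' s0)) := by
    ext ω
    rcases hy01 ω with h | h <;> simp [h, hs1, hs0]
  have hdisj : Disjoint ({ω | y ω = 1} ∩ X ⁻¹' s1)
      (X ⁻¹' s0 \ ({ω | y ω = 1} ∩ X ⁻¹' s0)) := by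
    rw [Set.disjoint_left]
    rintro ω ⟨h1, -⟩ ⟨h2, h3⟩
    exact h3 ⟨h1, h2⟩
  rw [Measure.add_apply, Measure.map_apply hm1 hs, Measure.map_apply hm0 hs,
    withDensity_apply _ ms1, withDensity_apply _ ms0, Measure.map_apply (hX.prodMk hy) hs, hset,
    measure_union hdisj ((hX ms0).diff (hy1.inter (hX ms0)))]
  congr 1
  · rw [← ofReal_integral_eq_lintegral_ofReal hint.integrableOn
      (ae_restrict_of_ae (hπ01.mono fun t ht => ht.1)),
      ← measureReal_inter_preimage_eq hX hy hπ hmodel ms1, ofReal_measureReal]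
  · rw [← ofReal_integral_eq_lintegral_ofReal hint'.integrableOn
      (ae_restrict_of_ae (hπ01.mono fun t ht => sub_nonneg.2 ht.2)),
      integral_sub (integrable_const 1).integrableOn hint.integrableOn,
      ← measureReal_inter_preimage_eq hX hy hπ hmodel ms0, setIntegral_const, smul_eq_mul, mul_one,
      map_measureReal_apply hX ms0, ← measureReal_sdiff Set.inter_subset_right
        (hy1.inter (hX ms0)), ofReal_measureReal]

variable {E : Type*} [NormedAddCommGroup E] {Q : Measure (S × ℝ)} {P : Measure S}

theorem ae_add_withDensity
    (hQ : Q = (P.withDensity fun t => ENNReal.ofReal (π t)).map (fun t => (t, (1 : ℝ))) +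
      (P.withDensity fun t => ENNReal.ofReal (1 - π t)).map (fun t => (t, (0 : ℝ))))
    {p : S × ℝ → Prop} (h1 : ∀ᵐ t ∂P, p (t, 1)) (h0 : ∀ᵐ t ∂P, p (t, 0)) : ∀ᵐ z ∂Q, p z := by
  have hm : ∀ c : ℝ, MeasurableEmbedding fun t : S => (t, c) := fun c =>
    measurableEmbedding_prod_mk_right c
  rw [hQ, ae_add_measure_iff, (hm 1).ae_map_iff, (hm 0).ae_map_iff]
  exact ⟨(withDensity_absolutelyContinuous _ _).ae_le h1,
    (withDensity_absolutelyContinuous _ _).ae_le h0⟩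

theorem integrable_add_withDensity_iff [NormedSpace ℝ E] (hπ : Measurable π)
    (hπ01 : ∀ᵐ t ∂P, π t ∈ Set.Icc (0 : ℝ) 1)
    (hQ : Q = (P.withDensity fun t => ENNReal.ofReal (π t)).map (fun t => (t, (1 : ℝ))) +
      (P.withDensity fun t => ENNReal.ofReal (1 - π t)).map (fun t => (t, (0 : ℝ))))
    {F : S × ℝ → E} :
    Integrable F Q ↔ Integrable (fun t => π t • F (t, 1)) P ∧
      Integrable (fun t => (1 - π t) • F (t, 0)) P := by
  have hm : ∀ c : ℝ, MeasurableEmbedding fun t : S => (t, c) := fun c =>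
    measurableEmbedding_prod_mk_right c
  rw [hQ, integrable_add_measure, (hm 1).integrable_map_iff, (hm 0).integrable_map_iff,
    integrable_withDensity_iff_integrable_smul' (by fun_prop) (by simp),
    integrable_withDensity_iff_integrable_smul' (by fun_prop) (by simp)]
  refine and_congr (integrable_congr ?_) (integrable_congr ?_)
  · filter_upwards [hπ01] with t ht
    simp [ENNReal.toReal_ofReal ht.1]
  · filter_upwards [hπ01] with t ht
    rw [ENNReal.toReal_ofReal (sub_nonneg.2 ht.2)]; rfl

theorem integral_add_withDensity [NormedSpace ℝ E] (hπ : Measurable π)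
    (hπ01 : ∀ᵐ t ∂P, π t ∈ Set.Icc (0 : ℝ) 1)
    (hQ : Q = (P.withDensity fun t => ENNReal.ofReal (π t)).map (fun t => (t, (1 : ℝ))) +
      (P.withDensity fun t => ENNReal.ofReal (1 - π t)).map (fun t => (t, (0 : ℝ))))
    {F : S × ℝ → E} (hF : Integrable F Q) :
    ∫ z, F z ∂Q = ∫ t, (π t • F (t, 1) + (1 - π t) • F (t, 0)) ∂P := by
  have hm : ∀ c : ℝ, MeasurableEmbedding fun t : S => (t, c) := fun c =>
    measurableEmbedding_prod_mk_right c
  have hF' := (integrable_add_withDensity_iff hπ hπ01 hQ).1 hF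
  rw [integral_add hF'.1 hF'.2]
  rw [hQ, integrable_add_measure] at hF
  rw [hQ, integral_add_measure hF.1 hF.2, (hm 1).integral_map, (hm 0).integral_map,
    integral_withDensity_eq_integral_toReal_smul (by fun_prop) (by simp),
    integral_withDensity_eq_integral_toReal_smul (by fun_prop) (by simp)]
  congr 1 <;> refine integral_congr_ae ?_
  · filter_upwards [hπ01] with t ht
    simp [ENNReal.toReal_ofReal ht.1]
  · filter_upwards [hπ01] with t ht
    simp only [ENNReal.toReal_ofReal (sub_nonneg.2 ht.2)]

theorem aestronglyMeasurable_comp_fst_add_withDensity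
    (hQ : Q = (P.withDensity fun t => ENNReal.ofReal (π t)).map (fun t => (t, (1 : ℝ))) +
      (P.withDensity fun t => ENNReal.ofReal (1 - π t)).map (fun t => (t, (0 : ℝ))))
    {φ : S → E} (hφ : AEStronglyMeasurable φ P) :
    AEStronglyMeasurable (fun z : S × ℝ => φ z.1) Q :=
  ⟨fun z => hφ.mk φ z.1, hφ.stronglyMeasurable_mk.comp_measurable measurable_fst,
    ae_add_withDensity (p := fun z => φ z.1 = hφ.mk φ z.1) hQ hφ.ae_eq_mk hφ.ae_eq_mk⟩

theorem integrable_comp_fst_add_withDensity [NormedSpace ℝ E] (hπ : Measurable π)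
    (hπ01 : ∀ᵐ t ∂P, π t ∈ Set.Icc (0 : ℝ) 1)
    (hQ : Q = (P.withDensity fun t => ENNReal.ofReal (π t)).map (fun t => (t, (1 : ℝ))) +
      (P.withDensity fun t => ENNReal.ofReal (1 - π t)).map (fun t => (t, (0 : ℝ))))
    {φ : S → E} (hφ : Integrable φ P) : Integrable (fun z : S × ℝ => φ z.1) Q := by
  rw [integrable_add_withDensity_iff hπ hπ01 hQ]
  constructor
  · refine hφ.mono (hπ.aestronglyMeasurable.smul hφ.aestronglyMeasurable) ?_
    filter_upwards [hπ01] with t ht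
    rw [norm_smul, Real.norm_of_nonneg ht.1]
    exact mul_le_of_le_one_left (norm_nonneg _) ht.2
  · refine hφ.mono ((measurable_const.sub hπ).aestronglyMeasurable.smul
      hφ.aestronglyMeasurable) ?_
    filter_upwards [hπ01] with t ht
    rw [norm_smul, Real.norm_of_nonneg (sub_nonneg.2 ht.2)]
    exact mul_le_of_le_one_left (norm_nonneg _) (by linarith [ht.1])

theorem integral_comp_fst_add_withDensity [NormedSpace ℝ E] (hπ : Measurable π)
    (hπ01 : ∀ᵐ t ∂P, π t ∈ Set.Icc (0 : ℝ) 1)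
    (hQ : Q = (P.withDensity fun t => ENNReal.ofReal (π t)).map (fun t => (t, (1 : ℝ))) +
      (P.withDensity fun t => ENNReal.ofReal (1 - π t)).map (fun t => (t, (0 : ℝ))))
    {φ : S → E} (hφ : Integrable φ P) : ∫ z, φ z.1 ∂Q = ∫ t, φ t ∂P := by
  rw [integral_add_withDensity hπ hπ01 hQ (integrable_comp_fst_add_withDensity hπ hπ01 hQ hφ)]
  congr 1 with t
  rw [← add_smul, add_sub_cancel, one_smul]

end BinaryResponse

end PriorEstimation

namespace PriorEstimation

/-! ### Calculus of the score -/

section Gradient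

variable {f p : ℕ} {g : Feature f → Param p → ℝ} {U : Set (Param p)} {t : Feature f}
  {θ : Param p}

theorem gradient_eq_toDual_symm (h : Param p → ℝ) (θ : Param p) :
    gradient h θ = (InnerProductSpace.toDual ℝ (Param p)).symm (fderiv ℝ h θ) := rfl

theorem norm_gradient (h : Param p → ℝ) (θ : Param p) : ‖gradient h θ‖ = ‖fderiv ℝ h θ‖ := by
  rw [gradient_eq_toDual_symm, LinearIsometryEquiv.norm_map]

theorem fderiv_apply_eq_sum_gradient (h : Param p → ℝ) (θ v : Param p) :
    fderiv ℝ h θ v = ∑ a, gradient h θ a * v a := by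
  rw [← InnerProductSpace.toDual_symm_apply, ← gradient_eq_toDual_symm, PiLp.inner_apply]
  simp [mul_comm]

theorem contDiffOn_gradient {h : Param p → ℝ} (hU : IsOpen U) (hh : ContDiffOn ℝ 2 h U) :
    ContDiffOn ℝ 1 (gradient h) U :=
  (InnerProductSpace.toDual ℝ (Param p)).symm.contDiff.comp_contDiffOn
    (hh.fderiv_of_isOpen hU (by norm_num))

theorem contDiffOn_weight (hg : ContDiffOn ℝ 2 (g t) U)
    (h01 : ∀ θ ∈ U, g t θ ∈ Set.Ioo (0 : ℝ) 1) : ContDiffOn ℝ 1 (weight g t) U := by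
  have hg1 : ContDiffOn ℝ 1 (g t) U := hg.of_le (by norm_num)
  refine contDiffOn_const.div (hg1.mul (contDiffOn_const.sub hg1)) fun θ hθ => ?_
  exact (mul_pos (h01 θ hθ).1 (sub_pos.2 (h01 θ hθ).2)).ne'

theorem contDiffOn_score (hU : IsOpen U) (hg : ContDiffOn ℝ 2 (g t) U)
    (h01 : ∀ θ ∈ U, g t θ ∈ Set.Ioo (0 : ℝ) 1) (y : ℝ) : ContDiffOn ℝ 1 (score g t y) U :=
  ((contDiffOn_weight hg h01).mul (contDiffOn_const.sub (hg.of_le (by norm_num)))).smul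
    (contDiffOn_gradient hU hg)

/-- The conditional mean of the derivative of the score, given the features. -/
theorem condMean_fderiv_score_apply (hU : IsOpen U) (hg : ContDiffOn ℝ 2 (g t) U)
    (h01 : ∀ θ ∈ U, g t θ ∈ Set.Ioo (0 : ℝ) 1) (hθ : θ ∈ U) (v : Param p) :
    (g t θ • fderiv ℝ (score g t 1) θ + (1 - g t θ) • fderiv ℝ (score g t 0) θ) v =
      -(weight g t θ * fderiv ℝ (g t) θ v) • gradient (g t) θ := by
  have hd : ∀ y, HasFDerivAt (score g t y) (fderiv ℝ (score g t y) θ) θ := fun y =>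
    (((contDiffOn_score hU hg h01 y).differentiableOn one_ne_zero).differentiableAt
      (hU.mem_nhds hθ)).hasFDerivAt
  have hgd : HasFDerivAt (g t) (fderiv ℝ (g t) θ) θ :=
    ((hg.differentiableOn two_ne_zero).differentiableAt (hU.mem_nhds hθ)).hasFDerivAt
  have hG : DifferentiableAt ℝ (fun ϑ => weight g t ϑ • gradient (g t) ϑ) θ :=
    (((contDiffOn_weight hg h01).smul (contDiffOn_gradient hU hg)).differentiableOn
      one_ne_zero).differentiableAt (hU.mem_nhds hθ)
  have h1 := ((hd 1).const_smul (g t θ)).add ((hd 0).const_smul (1 - g t θ))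
  have h2 := (hgd.const_sub (g t θ)).smul hG.hasFDerivAt
  -- With the mixture weights frozen at `θ`, the averaged score has the factor `g t θ - g t ϑ`. It
  -- vanishes at `ϑ = θ`, so the product rule discards the derivative of the weighted gradient and
  -- no second derivative of `g` survives.
  have e : (g t θ • score g t 1 + (1 - g t θ) • score g t 0) =
      ((fun ϑ => g t θ - g t ϑ) • fun ϑ => weight g t ϑ • gradient (g t) ϑ) := by
    funext ϑ
    simp only [Pi.add_apply, Pi.smul_apply, Pi.smul_apply', score, smul_smul, ← add_smul]
    congr 1
    ring
  rw [e] at h1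
  rw [h1.unique h2]
  simp [smul_smul, mul_comm]

end Gradient

/-! ### Moments of the score under the mixture law -/

section Regular

variable {f p : ℕ} {g : Feature f → Param p → ℝ} {Θ : Set (Param p)} {θ₀ : Param p}
  {P : Measure (Feature f)} {Q : Measure (Feature f × ℝ)}

theorem measurable_weight (hg : Measurable (Function.uncurry g)) (θ : Param p) :
    Measurable fun t => weight g t θ := by
  have : Measurable fun t => g t θ := hg.comp (measurable_id.prodMk measurable_const)
  unfold weight
  fun_prop

theorem measurable_section (hg : Measurable (Function.uncurry g)) (θ : Param p) :
    Measurable fun t => g t θ := hg.comp (measurable_id.prodMk measurable_const)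

theorem aestronglyMeasurable_gradient (hg : Measurable (Function.uncurry g)) {U : Set (Param p)}
    (hU : IsOpen U) (hC : ∀ᵐ t ∂P, ContDiffOn ℝ 2 (g t) U) {θ : Param p} (hθ : θ ∈ U) :
    AEStronglyMeasurable (fun t => gradient (g t) θ) P := by
  refine (InnerProductSpace.toDual ℝ (Param p)).symm.continuous.comp_aestronglyMeasurable
    (aestronglyMeasurable_fderiv hU hθ
      (fun ϑ _ => (measurable_section hg ϑ).aestronglyMeasurable) ?_)
  filter_upwards [hC] with t ht
  exact (ht.differentiableOn two_ne_zero).differentiableAt (hU.mem_nhds hθ)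

theorem IsRegularAt.mem (hreg : IsRegularAt g Θ θ₀ P) : θ₀ ∈ Θ := by
  obtain ⟨U, -, hθ, hUΘ, -⟩ := hreg.smooth
  exact hUΘ hθ

theorem IsRegularAt.ae_mem_Ioo (hreg : IsRegularAt g Θ θ₀ P) :
    ∀ᵐ t ∂P, g t θ₀ ∈ Set.Ioo (0 : ℝ) 1 :=
  hreg.mem_Ioo.mono fun _ ht => ht θ₀ hreg.mem

theorem IsRegularAt.ae_mem_Icc (hreg : IsRegularAt g Θ θ₀ P) :
    ∀ᵐ t ∂P, g t θ₀ ∈ Set.Icc (0 : ℝ) 1 :=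
  hreg.ae_mem_Ioo.mono fun _ ht => Set.Ioo_subset_Icc_self ht

theorem IsRegularAt.aestronglyMeasurable_gradient (hreg : IsRegularAt g Θ θ₀ P) :
    AEStronglyMeasurable (fun t => gradient (g t) θ₀) P := by
  obtain ⟨U, hU, hθ, -, hC, -⟩ := hreg.smooth
  exact PriorEstimation.aestronglyMeasurable_gradient hreg.measurable hU hC hθ

theorem aestronglyMeasurable_apply {S : Type*} [MeasurableSpace S] {ν : Measure S}
    {F : S → Param p} (hF : AEStronglyMeasurable F ν) (a : Fin p) :
    AEStronglyMeasurable (fun s => F s a) ν :=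
  (EuclideanSpace.proj (𝕜 := ℝ) a).continuous.comp_aestronglyMeasurable hF

theorem IsRegularAt.integrable_weight_mul (hreg : IsRegularAt g Θ θ₀ P) (a b : Fin p) :
    Integrable (fun t => weight g t θ₀ * gradient (g t) θ₀ a * gradient (g t) θ₀ b) P := by
  have hm := hreg.aestronglyMeasurable_gradient
  refine hreg.integrable_weight.mono
    (((measurable_weight hreg.measurable θ₀).aestronglyMeasurable.mul
      (aestronglyMeasurable_apply hm a)).mul (aestronglyMeasurable_apply hm b)) (ae_of_all _ fun t => ?_)
  rw [norm_mul, norm_mul, norm_mul, norm_pow, norm_norm, mul_assoc, sq]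
  gcongr <;> exact PiLp.norm_apply_le _ _

theorem matA_apply_map {Ω : Type*} [MeasurableSpace Ω] {μ : Measure Ω} {X : Ω → Feature f}
    (hX : AEMeasurable X μ) (hreg : IsRegularAt g Θ θ₀ (μ.map X)) (a b : Fin p) :
    matA μ g X θ₀ a b =
      ∫ t, weight g t θ₀ * gradient (g t) θ₀ a * gradient (g t) θ₀ b ∂(μ.map X) :=
  (integral_map hX (hreg.integrable_weight_mul a b).aestronglyMeasurable).symm

theorem vecB_apply_map {Ω : Type*} [MeasurableSpace Ω] {μ : Measure Ω} {X : Ω → Feature f}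
    (hX : AEMeasurable X μ) (hreg : IsRegularAt g Θ θ₀ (μ.map X)) (a : Fin p) :
    vecB μ g X θ₀ a = ∫ t, gradient (g t) θ₀ a ∂(μ.map X) :=
  (integral_map hX (aestronglyMeasurable_apply hreg.aestronglyMeasurable_gradient a)).symm

theorem matA_transpose {Ω : Type*} [MeasurableSpace Ω] {μ : Measure Ω} {X : Ω → Feature f} :
    (matA μ g X θ₀)ᵀ = matA μ g X θ₀ := by
  ext a b
  simp only [matA, Matrix.transpose_apply, Matrix.of_apply]
  congr 1 with ω
  ring

theorem weight_mul_mul {t : Feature f} (h : g t θ₀ ∈ Set.Ioo (0 : ℝ) 1) :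
    weight g t θ₀ * (g t θ₀ * (1 - g t θ₀)) = 1 := by
  rw [weight, one_div, inv_mul_cancel₀]
  exact (mul_pos h.1 (sub_pos.2 h.2)).ne'

section Joint

variable (hQ : Q = (P.withDensity fun t => ENNReal.ofReal (g t θ₀)).map (fun t => (t, (1 : ℝ))) +
  (P.withDensity fun t => ENNReal.ofReal (1 - g t θ₀)).map (fun t => (t, (0 : ℝ))))

include hQ

theorem aestronglyMeasurable_score (hg : Measurable (Function.uncurry g)) {U : Set (Param p)}
    (hU : IsOpen U) (hC : ∀ᵐ t ∂P, ContDiffOn ℝ 2 (g t) U) {θ : Param p} (hθ : θ ∈ U) :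
    AEStronglyMeasurable (fun z : Feature f × ℝ => score g z.1 z.2 θ) Q := by
  have h1 : Measurable fun z : Feature f × ℝ => weight g z.1 θ * (z.2 - g z.1 θ) :=
    ((measurable_weight hg θ).comp measurable_fst).mul
      (measurable_snd.sub ((measurable_section hg θ).comp measurable_fst))
  exact h1.aestronglyMeasurable.smul (aestronglyMeasurable_comp_fst_add_withDensity hQ
     (aestronglyMeasurable_gradient hg hU hC hθ))

theorem IsRegularAt.aestronglyMeasurable_score (hreg : IsRegularAt g Θ θ₀ P) :
    AEStronglyMeasurable (fun z : Feature f × ℝ => score g z.1 z.2 θ₀) Q := by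
  obtain ⟨U, hU, hθ, -, hC, -⟩ := hreg.smooth
  exact PriorEstimation.aestronglyMeasurable_score hQ hreg.measurable hU hC hθ

/-- Because `w g (1 - g) = 1`, the label-1 and label-0 parts equal `1 - g` and `g` times the
integrand of `A`. They are therefore dominated by it, and they add up to it. -/
theorem IsRegularAt.integrable_score_mul_score (hreg : IsRegularAt g Θ θ₀ P) (a b : Fin p) :
    Integrable (fun z : Feature f × ℝ => score g z.1 z.2 θ₀ a * score g z.1 z.2 θ₀ b) Q := by
  have hπ := measurable_section hreg.measurable θ₀
  rw [integrable_add_withDensity_iff hπ hreg.ae_mem_Icc hQ]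
  have hw := hreg.integrable_weight_mul a b
  constructor
  · refine (hw.mono ((measurable_const.sub hπ).aestronglyMeasurable.mul hw.aestronglyMeasurable)
      (f := fun t => (1 - g t θ₀) * _) ?_).congr ?_
    · filter_upwards [hreg.ae_mem_Ioo] with t ht
      rw [norm_mul, Real.norm_of_nonneg (sub_nonneg.2 ht.2.le)]
      exact mul_le_of_le_one_left (norm_nonneg _) (by linarith [ht.1])
    · filter_upwards [hreg.ae_mem_Ioo] with t ht
      have := weight_mul_mul ht
      simp only [score, PiLp.smul_apply, smul_eq_mul]
      linear_combination (-(weight g t θ₀) * (1 - g t θ₀) * gradient (g t) θ₀ a *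
        gradient (g t) θ₀ b) * this
  · refine (hw.mono (hπ.aestronglyMeasurable.mul hw.aestronglyMeasurable)
      (f := fun t => g t θ₀ * _) ?_).congr ?_
    · filter_upwards [hreg.ae_mem_Ioo] with t ht
      rw [norm_mul, Real.norm_of_nonneg ht.1.le]
      exact mul_le_of_le_one_left (norm_nonneg _) ht.2.le
    · filter_upwards [hreg.ae_mem_Ioo] with t ht
      have := weight_mul_mul ht
      simp only [score, PiLp.smul_apply, smul_eq_mul]
      linear_combination (-(weight g t θ₀) * g t θ₀ * gradient (g t) θ₀ a *
        gradient (g t) θ₀ b) * this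

theorem IsRegularAt.integral_score_mul_score (hreg : IsRegularAt g Θ θ₀ P) (a b : Fin p) :
    ∫ z : Feature f × ℝ, score g z.1 z.2 θ₀ a * score g z.1 z.2 θ₀ b ∂Q =
      ∫ t, weight g t θ₀ * gradient (g t) θ₀ a * gradient (g t) θ₀ b ∂P := by
  rw [integral_add_withDensity (measurable_section hreg.measurable θ₀) hreg.ae_mem_Icc hQ
    (hreg.integrable_score_mul_score hQ a b)]
  refine integral_congr_ae ?_
  filter_upwards [hreg.ae_mem_Ioo] with t ht
  have := weight_mul_mul ht
  simp only [score, PiLp.smul_apply, smul_eq_mul]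
  linear_combination ((weight g t θ₀) * gradient (g t) θ₀ a *
        gradient (g t) θ₀ b) * this

theorem IsRegularAt.memLp_score (hreg : IsRegularAt g Θ θ₀ P) (a : Fin p) :
    MemLp (fun z : Feature f × ℝ => score g z.1 z.2 θ₀ a) 2 Q := by
  rw [memLp_two_iff_integrable_sq
    (aestronglyMeasurable_apply (hreg.aestronglyMeasurable_score hQ) a)]
  simpa only [sq] using hreg.integrable_score_mul_score hQ a a

/-- Given the features the score has mean zero, as `g (1 - g) + (1 - g)(0 - g) = 0`. This is the
source of both centering and uncorrelatedness. -/
theorem IsRegularAt.integral_mul_score [IsFiniteMeasure Q] (hreg : IsRegularAt g Θ θ₀ P)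
    {φ : Feature f → ℝ} (hφ : MemLp (fun z : Feature f × ℝ => φ z.1) 2 Q) (a : Fin p) :
    ∫ z : Feature f × ℝ, φ z.1 * score g z.1 z.2 θ₀ a ∂Q = 0 := by
  have hint : Integrable (fun z : Feature f × ℝ => φ z.1 * score g z.1 z.2 θ₀ a) Q :=
    hφ.integrable_mul (hreg.memLp_score hQ a)
  rw [integral_add_withDensity (measurable_section hreg.measurable θ₀) hreg.ae_mem_Icc hQ hint]
  refine integral_eq_zero_of_ae (ae_of_all _ fun t => ?_)
  simp only [Pi.zero_apply]
  simp only [score, PiLp.smul_apply, smul_eq_mul]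
  ring

theorem IsRegularAt.integral_score [IsFiniteMeasure Q] (hreg : IsRegularAt g Θ θ₀ P)
    (a : Fin p) : ∫ z : Feature f × ℝ, score g z.1 z.2 θ₀ a ∂Q = 0 := by
  simpa using hreg.integral_mul_score hQ (φ := fun _ => 1) (memLp_const 1) a

theorem integrable_fderiv_score (hreg : IsRegularAt g Θ θ₀ P) :
    Integrable (fun z : Feature f × ℝ => fderiv ℝ (score g z.1 z.2) θ₀) Q := by
  obtain ⟨U, hU, hθ, hUΘ, hC, M, hM, hb⟩ := hreg.smooth
  have hπ := measurable_section hreg.measurable θ₀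
  have hdiff : ∀ y : ℝ, ∀ᵐ t ∂P, DifferentiableAt ℝ (score g t y) θ₀ := fun y => by
    filter_upwards [hC, hreg.mem_Ioo] with t ht h01
    exact ((contDiffOn_score hU ht (fun ϑ hϑ => h01 ϑ (hUΘ hϑ)) y).differentiableOn
      one_ne_zero).differentiableAt (hU.mem_nhds hθ)
  refine (integrable_comp_fst_add_withDensity hπ hreg.ae_mem_Icc hQ hM).mono'
    (aestronglyMeasurable_fderiv (F := fun z : Feature f × ℝ => score g z.1 z.2) hU hθ
      (fun ϑ hϑ => PriorEstimation.aestronglyMeasurable_score hQ hreg.measurable hU hC hϑ)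
      (ae_add_withDensity hQ (hdiff 1) (hdiff 0)))
    (ae_add_withDensity hQ ?_ ?_)
  · exact hb.mono fun t ht => (ht θ₀ hθ).2 1 (by simp)
  · exact hb.mono fun t ht => (ht θ₀ hθ).2 0 (by simp)

/-- The information identity: the mean derivative of the score is minus its second moment matrix. -/
theorem integral_fderiv_score_apply (hreg : IsRegularAt g Θ θ₀ P) (v : Param p) (a : Fin p) :
    (∫ z : Feature f × ℝ, fderiv ℝ (score g z.1 z.2) θ₀ ∂Q) v a =
      -∑ b, (∫ t, weight g t θ₀ * gradient (g t) θ₀ a * gradient (g t) θ₀ b ∂P) * v b := by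
  have hint := integrable_fderiv_score hQ hreg
  have hπ := measurable_section hreg.measurable θ₀
  let T : (Param p →L[ℝ] Param p) →L[ℝ] ℝ :=
    (EuclideanSpace.proj (𝕜 := ℝ) a).comp (ContinuousLinearMap.apply ℝ (Param p) v)
  have hi := (integrable_add_withDensity_iff hπ hreg.ae_mem_Icc hQ).1 hint
  have e : (∫ z : Feature f × ℝ, fderiv ℝ (score g z.1 z.2) θ₀ ∂Q) v a =
    T (∫ z : Feature f × ℝ, fderiv ℝ (score g z.1 z.2) θ₀ ∂Q) := rfl
  rw [e, integral_add_withDensity hπ hreg.ae_mem_Icc hQ hint,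
    ← T.integral_comp_comm (φ := fun t => g t θ₀ • fderiv ℝ (score g t 1) θ₀
      + (1 - g t θ₀) • fderiv ℝ (score g t 0) θ₀) (hi.1.add hi.2)]
  simp_rw [← integral_mul_const]
  rw [← integral_finsetSum _ fun b _ => (hreg.integrable_weight_mul a b).mul_const _,
    ← integral_neg]
  obtain ⟨U, hU, hθ, hUΘ, hC, -⟩ := hreg.smooth
  refine integral_congr_ae ?_
  filter_upwards [hC, hreg.mem_Ioo] with t ht h01
  have := condMean_fderiv_score_apply hU ht (fun ϑ hϑ => h01 ϑ (hUΘ hϑ)) hθ v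
  change ((g t θ₀ • fderiv ℝ (score g t 1) θ₀
    + (1 - g t θ₀) • fderiv ℝ (score g t 0) θ₀) v) a = _
  rw [this, fderiv_apply_eq_sum_gradient, PiLp.smul_apply, smul_eq_mul, neg_mul, Finset.mul_sum,
    Finset.sum_mul]
  congr 1
  exact Finset.sum_congr rfl fun b _ => by ring

end Joint

end Regular

end PriorEstimation

namespace PriorEstimation

/-! ### Second moments, Chebyshev bounds, and the limit law of the linear part -/

section SecondMoments

variable {Ω : Type*} [MeasurableSpace Ω] {μ : Measure Ω}
  {E : Type*} [MeasurableSpace E] {Z : ℕ → Ω → E}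

theorem memLp_comp_of_identDistrib (hident : ∀ i, IdentDistrib (Z i) (Z 0) μ μ) {u : E → ℝ}
    (hu : MemLp u 2 (μ.map (Z 0))) (i : ℕ) : MemLp (fun ω => u (Z i ω)) 2 μ :=
  MemLp.comp_of_map (by rwa [(hident i).map_eq]) (hident i).aemeasurable_fst

theorem covariance_comp_eq [IsProbabilityMeasure μ] (hindep : iIndepFun Z μ)
    (hident : ∀ i, IdentDistrib (Z i) (Z 0) μ μ) {u v : E → ℝ}
    (hu : MemLp u 2 (μ.map (Z 0))) (hv : MemLp v 2 (μ.map (Z 0))) (i j : ℕ) :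
    cov[fun ω => u (Z i ω), fun ω => v (Z j ω); μ] =
      if i = j then cov[u, v; μ.map (Z 0)] else 0 := by
  have hZ := fun i => (hident i).aemeasurable_fst
  split_ifs with h
  · subst h
    rw [← (hident i).map_eq, covariance_map_fun _ _ (hZ i)] <;>
    rw [(hident i).map_eq]
    exacts [hu.aestronglyMeasurable, hv.aestronglyMeasurable]
  · refine IndepFun.covariance_eq_zero ?_ (memLp_comp_of_identDistrib hident hu i)
      (memLp_comp_of_identDistrib hident hv j)
    refine (hindep.indepFun h).comp₀ (hZ i) (hZ j) ?_ ?_ <;> rw [(hident _).map_eq]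
    exacts [hu.aestronglyMeasurable.aemeasurable, hv.aestronglyMeasurable.aemeasurable]

theorem covariance_sum_sum_eq [IsProbabilityMeasure μ] (hindep : iIndepFun Z μ)
    (hident : ∀ i, IdentDistrib (Z i) (Z 0) μ μ) {u v : E → ℝ}
    (hu : MemLp u 2 (μ.map (Z 0))) (hv : MemLp v 2 (μ.map (Z 0))) {m n : ℕ} (hmn : m ≤ n) :
    cov[fun ω => ∑ i ∈ Finset.range n, u (Z i ω), fun ω => ∑ i ∈ Finset.range m, v (Z i ω); μ] =
      m * cov[u, v; μ.map (Z 0)] := by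
  rw [covariance_fun_sum_fun_sum' (fun i _ => memLp_comp_of_identDistrib hident hu i)
    (fun i _ => memLp_comp_of_identDistrib hident hv i), Finset.sum_comm]
  simp_rw [covariance_comp_eq hindep hident hu hv]
  rw [Finset.sum_congr rfl (g := fun _ => cov[u, v; μ.map (Z 0)])]
  · simp
  · intro i hi
    rw [Finset.sum_ite_eq' , if_pos (Finset.mem_range.2 ((Finset.mem_range.1 hi).trans_le hmn))]

theorem variance_sum_eq [IsProbabilityMeasure μ] (hindep : iIndepFun Z μ)
    (hident : ∀ i, IdentDistrib (Z i) (Z 0) μ μ) {u : E → ℝ}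
    (hu : MemLp u 2 (μ.map (Z 0))) (n : ℕ) :
    Var[fun ω => ∑ i ∈ Finset.range n, u (Z i ω); μ] = n * Var[u; μ.map (Z 0)] := by
  rw [← covariance_self, covariance_sum_sum_eq hindep hident hu hu le_rfl, covariance_self]
  · exact hu.aestronglyMeasurable.aemeasurable
  · exact Finset.aemeasurable_fun_sum _ fun i _ =>
      (memLp_comp_of_identDistrib hident hu i).aestronglyMeasurable.aemeasurable

theorem integral_sum_sq_eq [IsProbabilityMeasure μ] (hindep : iIndepFun Z μ)
    (hident : ∀ i, IdentDistrib (Z i) (Z 0) μ μ) {u : E → ℝ}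
    (hu : MemLp u 2 (μ.map (Z 0))) (hu0 : ∫ z, u z ∂(μ.map (Z 0)) = 0) (n : ℕ) :
    ∫ ω, (∑ i ∈ Finset.range n, u (Z i ω)) ^ 2 ∂μ = n * ∫ z, u z ^ 2 ∂(μ.map (Z 0)) := by
  have hm := memLp_comp_of_identDistrib hident hu
  have hsum : MemLp (fun ω => ∑ i ∈ Finset.range n, u (Z i ω)) 2 μ :=
    memLp_finsetSum _ fun i _ => hm i
  have h0 : ∫ ω, ∑ i ∈ Finset.range n, u (Z i ω) ∂μ = 0 := by
    rw [integral_finsetSum _ fun i _ => (hm i).integrable one_le_two]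
    refine Finset.sum_eq_zero fun i _ => ?_
    rw [← hu0, ← (hident i).map_eq, integral_map (hident i).aemeasurable_fst]
    rw [(hident i).map_eq]; exact hu.aestronglyMeasurable
  have := variance_sum_eq hindep hident hu n
  rwa [variance_of_integral_eq_zero hsum.aestronglyMeasurable.aemeasurable h0,
    variance_of_integral_eq_zero hu.aestronglyMeasurable.aemeasurable hu0] at this

theorem measureReal_le_abs_sum [IsProbabilityMeasure μ] (hindep : iIndepFun Z μ)
    (hident : ∀ i, IdentDistrib (Z i) (Z 0) μ μ) {u : E → ℝ}
    (hu : MemLp u 2 (μ.map (Z 0))) (hu0 : ∫ z, u z ∂(μ.map (Z 0)) = 0) (n : ℕ) (c : ℝ) {η : ℝ}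
    (hη : 0 < η) :
    μ.real {ω | η ≤ |c * ∑ i ∈ Finset.range n, u (Z i ω)|} ≤
      c ^ 2 * (n * ∫ z, u z ^ 2 ∂(μ.map (Z 0))) / η ^ 2 := by
  have hsum : MemLp (fun ω => ∑ i ∈ Finset.range n, u (Z i ω)) 2 μ :=
    memLp_finsetSum _ fun i _ => memLp_comp_of_identDistrib hident hu i
  have h := mul_meas_ge_le_integral_of_nonneg (μ := μ)
    (f := fun ω => c ^ 2 * (∑ i ∈ Finset.range n, u (Z i ω)) ^ 2)
    (ae_of_all _ fun ω => by positivity) (hsum.integrable_sq.const_mul _) (η ^ 2)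
  rw [integral_const_mul, integral_sum_sq_eq hindep hident hu hu0] at h
  rw [le_div_iff₀' (by positivity)]
  refine le_trans (mul_le_mul_of_nonneg_left (measureReal_mono fun ω hω => ?_) (by positivity)) h
  rw [Set.mem_ofPred_eq] at hω ⊢
  rw [← mul_pow, ← sq_abs (c * _)]
  gcongr

/-- Chebyshev, coordinate by coordinate. It supplies the rate at which the score average at the true
parameter tends to 0. -/
theorem measureReal_le_norm_sum [IsProbabilityMeasure μ] {p : ℕ} (hindep : iIndepFun Z μ)
    (hident : ∀ i, IdentDistrib (Z i) (Z 0) μ μ) {F : E → Param p}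
    (hF : ∀ a, MemLp (fun z => F z a) 2 (μ.map (Z 0)))
    (hF0 : ∀ a, ∫ z, F z a ∂(μ.map (Z 0)) = 0) (n : ℕ) {η : ℝ} (hη : 0 < η) :
    μ.real {ω | η ≤ ‖(n : ℝ)⁻¹ • ∑ i ∈ Finset.range n, F (Z i ω)‖} ≤
      (n : ℝ)⁻¹ * (∑ a, ∫ z, F z a ^ 2 ∂(μ.map (Z 0))) / η ^ 2 := by
  have hsum : ∀ a, MemLp (fun ω => ∑ i ∈ Finset.range n, F (Z i ω) a) 2 μ := fun a =>
    memLp_finsetSum _ fun i _ => memLp_comp_of_identDistrib hident (hF a) i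
  have hnorm : ∀ ω, ‖(n : ℝ)⁻¹ • ∑ i ∈ Finset.range n, F (Z i ω)‖ ^ 2 =
      ∑ a, (n : ℝ)⁻¹ ^ 2 * (∑ i ∈ Finset.range n, F (Z i ω) a) ^ 2 := by
    intro ω
    rw [EuclideanSpace.real_norm_sq_eq]
    refine Finset.sum_congr rfl fun a _ => ?_
    rw [PiLp.smul_apply, smul_eq_mul, mul_pow, WithLp.ofLp_sum, Finset.sum_apply]
  have h := mul_meas_ge_le_integral_of_nonneg (μ := μ)
    (f := fun ω => ∑ a, (n : ℝ)⁻¹ ^ 2 * (∑ i ∈ Finset.range n, F (Z i ω) a) ^ 2)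
    (ae_of_all _ fun ω => by positivity)
    (integrable_finsetSum _ fun a _ => (hsum a).integrable_sq.const_mul _) (η ^ 2)
  rw [integral_finsetSum _ fun a _ => (hsum a).integrable_sq.const_mul _] at h
  simp_rw [integral_const_mul, integral_sum_sq_eq hindep hident (hF _) (hF0 _)] at h
  rw [le_div_iff₀' (by positivity)]
  refine (mul_le_mul_of_nonneg_left (measureReal_mono fun ω hω => ?_) (by positivity)).trans
    (h.trans (le_of_eq ?_))
  · rw [Set.mem_ofPred_eq] at hω ⊢
    rw [← hnorm]
    gcongr
  · rw [Finset.mul_sum]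
    refine Finset.sum_congr rfl fun a _ => ?_
    rcases eq_or_ne n 0 with rfl | hn
    · simp
    · have : (n : ℝ) ≠ 0 := by exact_mod_cast hn
      field_simp

/-- A central limit theorem for the sum of a full-sample average and a subsample average of
uncorrelated summands. -/
theorem clt_sum_of_averages [IsProbabilityMeasure μ] (hindep : iIndepFun Z μ)
    (hident : ∀ i, IdentDistrib (Z i) (Z 0) μ μ) {u v : E → ℝ}
    (hu : MemLp u 2 (μ.map (Z 0))) (hv : MemLp v 2 (μ.map (Z 0)))
    (hu0 : ∫ z, u z ∂(μ.map (Z 0)) = 0) (hv0 : ∫ z, v z ∂(μ.map (Z 0)) = 0)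
    (huv : ∫ z, u z * v z ∂(μ.map (Z 0)) = 0)
    {r : ℕ → ℕ} (hr : ∀ n, r n ≤ n) {γ : ℝ} (hγ : 0 < γ)
    (hrγ : Tendsto (fun n => (r n : ℝ) / (n : ℝ)) atTop (𝓝 γ)) {s : ℝ}
    (hs : s = ∫ z, u z ^ 2 ∂(μ.map (Z 0)) + γ⁻¹ * ∫ z, v z ^ 2 ∂(μ.map (Z 0))) :
    TendstoInDistribution (fun (n : ℕ) ω => √(n : ℝ) *
      ((1 / (n : ℝ)) * ∑ i ∈ Finset.range n, u (Z i ω) +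
        (1 / (r n : ℝ)) * ∑ i ∈ Finset.range (r n), v (Z i ω)))
      atTop (id : ℝ → ℝ) (fun _ => μ) (gaussianReal 0 s.toNNReal) := by
  have hpm : IsProbabilityMeasure (μ.map (Z 0)) :=
    Measure.isProbabilityMeasure_map (hident 0).aemeasurable_fst
  have ha : MemLp (fun z => u z + γ⁻¹ * v z) 2 (μ.map (Z 0)) := hu.add (hv.const_mul _)
  have ha0 : ∫ z, u z + γ⁻¹ * v z ∂(μ.map (Z 0)) = 0 := by
    rw [integral_add (hu.integrable one_le_two) ((hv.integrable one_le_two).const_mul _),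
      integral_const_mul, hu0, hv0]
    simp
  have hasq : ∫ z, (u z + γ⁻¹ * v z) ^ 2 ∂(μ.map (Z 0)) =
      ∫ z, u z ^ 2 ∂(μ.map (Z 0)) + γ⁻¹ ^ 2 * ∫ z, v z ^ 2 ∂(μ.map (Z 0)) := by
    have e : ∀ z, (u z + γ⁻¹ * v z) ^ 2 = (u z ^ 2 + γ⁻¹ ^ 2 * v z ^ 2) + 2 * γ⁻¹ * (u z * v z) :=
      fun z => by ring
    simp_rw [e]
    have h12 : Integrable (fun z => u z ^ 2 + γ⁻¹ ^ 2 * v z ^ 2) (μ.map (Z 0)) :=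
      hu.integrable_sq.add (hv.integrable_sq.const_mul _)
    have h3 : Integrable (fun z => u z * v z) (μ.map (Z 0)) := hu.integrable_mul hv
    rw [integral_add h12 (h3.const_mul _), integral_const_mul, huv,
      integral_add hu.integrable_sq (hv.integrable_sq.const_mul _), integral_const_mul]
    ring
  have hs0 : 0 ≤ s := by rw [hs]; positivity
  -- With `1/r` replaced by `1/(γn)`, a labeled index contributes `u + γ⁻¹ v` and an unlabeled one
  -- `u`. The variance is `γ(E u² + γ⁻² E v²) + (1 - γ) E u² = s`.
  have hclt := clt_two_sample hindep hident ha hu ha0 hu0 hr hrγ (s := s)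
    (by rw [hs, hasq]; field_simp; ring) hs0
  have hmu : ∀ i, AEMeasurable (fun ω => u (Z i ω)) μ := fun i =>
    (memLp_comp_of_identDistrib hident hu i).aestronglyMeasurable.aemeasurable
  have hmv : ∀ i, AEMeasurable (fun ω => v (Z i ω)) μ := fun i =>
    (memLp_comp_of_identDistrib hident hv i).aestronglyMeasurable.aemeasurable
  refine tendstoInDistribution_of_tendstoInMeasure_sub _ _ hclt ?_ fun n =>
    (((Finset.aemeasurable_fun_sum _ fun i _ => hmu i).const_mul _).add
      ((Finset.aemeasurable_fun_sum _ fun i _ => hmv i).const_mul _)).const_mul _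
  rw [tendstoInMeasure_iff_measureReal_norm]
  intro η hη
  -- This is the Chebyshev bound for the cost of replacing `1/r` by `1/(γn)`.
  have hlim : Tendsto (fun n : ℕ => (((r n : ℝ) / n)⁻¹ - γ⁻¹) ^ 2 * ((r n : ℝ) / n) *
      (∫ z, v z ^ 2 ∂(μ.map (Z 0))) / η ^ 2) atTop (𝓝 0) := by
    have := (((((hrγ.inv₀ hγ.ne').sub_const γ⁻¹).pow 2).mul hrγ).mul_const
      (∫ z, v z ^ 2 ∂(μ.map (Z 0)))).div_const (η ^ 2)
    simpa using this
  refine squeeze_zero' (Eventually.of_forall fun _ => measureReal_nonneg) ?_ hlim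
  filter_upwards [eventually_gt_atTop 0, hrγ.eventually (lt_mem_nhds hγ)] with n hn hrn
  have hn' : (0 : ℝ) < n := by exact_mod_cast hn
  have hr' : (0 : ℝ) < r n := by
    by_contra h
    have : (r n : ℝ) = 0 := le_antisymm (not_lt.1 h) (Nat.cast_nonneg _)
    simp [this] at hrn
  have hsq := Real.mul_self_sqrt hn'.le
  have hsn : 0 < √(n : ℝ) := Real.sqrt_pos.2 hn'
  have h := measureReal_le_abs_sum hindep hident hv hv0 (r n)
    ((√(n : ℝ))⁻¹ * (((r n : ℝ) / n)⁻¹ - γ⁻¹)) hη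
  have e1 : ((√(n : ℝ))⁻¹ * (((r n : ℝ) / n)⁻¹ - γ⁻¹)) ^ 2 *
      (r n * ∫ z, v z ^ 2 ∂(μ.map (Z 0))) / η ^ 2 = (((r n : ℝ) / n)⁻¹ - γ⁻¹) ^ 2 *
      ((r n : ℝ) / n) * (∫ z, v z ^ 2 ∂(μ.map (Z 0))) / η ^ 2 := by
    rw [mul_pow, inv_pow, sq (√(n : ℝ)), hsq]
    ring
  rw [e1] at h
  refine le_trans (le_of_eq ?_) h
  congr 1
  ext ω
  simp only [Set.mem_ofPred_eq, Pi.sub_apply, Pi.zero_apply, sub_zero, Real.norm_eq_abs]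
  have e2 : √(n : ℝ) * (1 / (n : ℝ) * ∑ i ∈ Finset.range n, u (Z i ω) +
        1 / (r n : ℝ) * ∑ i ∈ Finset.range (r n), v (Z i ω)) -
      (√(n : ℝ))⁻¹ * (∑ i ∈ Finset.range (r n), (u (Z i ω) + γ⁻¹ * v (Z i ω)) +
        ∑ i ∈ Finset.Ico (r n) n, u (Z i ω)) =
      (√(n : ℝ))⁻¹ * (((r n : ℝ) / n)⁻¹ - γ⁻¹) * ∑ i ∈ Finset.range (r n), v (Z i ω) := by
    rw [Finset.sum_add_distrib, ← Finset.mul_sum, add_right_comm,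
      Finset.sum_range_add_sum_Ico _ (hr n)]
    have hnn : (n : ℝ) = √(n : ℝ) * √(n : ℝ) := hsq.symm
    set q := √(n : ℝ)
    rw [hnn]
    field_simp
    ring
  rw [e2]

end SecondMoments

end PriorEstimation

namespace PriorEstimation

/-! ### The remainder of the linear expansion -/

section Remainder

open scoped NNReal

variable {f p : ℕ} {g : Feature f → Param p → ℝ} {Θ : Set (Param p)} {θ₀ : Param p}

/-- The root constructed near `θ₀` lies in `Θ`, so the estimator is a root too, and uniqueness makes
the two equal. The estimator thereby inherits the distance bound. -/
theorem abs_priorEstimate_sub_add_le {x : ℕ → Feature f} {y : ℕ → ℝ} {r n : ℕ} {δ K : ℝ} {ε : ℝ≥0}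
    {J : Param p ≃L[ℝ] Param p} {B : Param p →L[ℝ] ℝ} {ϑ : Param p}
    (hΨ : ApproximatesLinearOn (fun θ => (r : ℝ)⁻¹ • ∑ i ∈ Finset.range r, score g (x i) (y i) θ)
      (J : Param p →L[ℝ] Param p) (Metric.closedBall θ₀ δ) ε)
    (hG : ApproximatesLinearOn (fun θ => (n : ℝ)⁻¹ • ∑ i ∈ Finset.range n, g (x i) θ) B
      (Metric.closedBall θ₀ δ) ε)
    (hK : 0 < K) (hJ : ∀ v, ‖J.symm v‖ ≤ K * ‖v‖) (hεK : ε * K ≤ 1 / 2)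
    (hΘ : Metric.closedBall θ₀ δ ⊆ Θ) (hr : 0 < r)
    (hsmall : 2 * K * ‖(r : ℝ)⁻¹ • ∑ i ∈ Finset.range r, score g (x i) (y i) θ₀‖ ≤ δ)
    (huniq : Set.Subsingleton {θ ∈ Θ | IsLabeledRoot g r x y θ})
    (hroot : (∃ θ ∈ Θ, IsLabeledRoot g r x y θ) → ϑ ∈ Θ ∧ IsLabeledRoot g r x y ϑ) :
    |priorEstimate g n x ϑ - (n : ℝ)⁻¹ • ∑ i ∈ Finset.range n, g (x i) θ₀
      + B (J.symm ((r : ℝ)⁻¹ • ∑ i ∈ Finset.range r, score g (x i) (y i) θ₀))| ≤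
      ε * (2 * K * (1 + ‖B‖ * K)) *
        ‖(r : ℝ)⁻¹ • ∑ i ∈ Finset.range r, score g (x i) (y i) θ₀‖ := by
  have hr' : (r : ℝ)⁻¹ ≠ 0 := inv_ne_zero (by exact_mod_cast hr.ne')
  have hball := Metric.closedBall_subset_closedBall (x := θ₀) hsmall
  obtain ⟨θ₁, h1, h2⟩ := exists_root_of_approximatesLinearOn hΨ hK hJ hεK hball
  have hδ : 0 ≤ δ := le_trans (by positivity) hsmall
  have h3 : IsLabeledRoot g r x y θ₁ := (smul_eq_zero.1 h2).resolve_left hr'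
  have hmem : θ₁ ∈ Θ := hΘ (hball h1)
  have heq : ϑ = θ₁ := huniq (hroot ⟨θ₁, hmem, h3⟩) ⟨hmem, h3⟩
  subst heq
  have h := abs_sub_add_le_of_approximatesLinearOn hΨ hG hK hJ (Metric.mem_closedBall_self hδ)
    (hball h1) h2 (mem_closedBall_iff_norm.1 h1)
  simpa only [priorEstimate, one_div, smul_eq_mul] using h

variable {Ω : Type*} [MeasurableSpace Ω] {μ : Measure Ω} [IsProbabilityMeasure μ]
  {Z : ℕ → Ω → Feature f × ℝ} {P : Measure (Feature f)}

theorem tendstoInMeasure_remainder (hindep : iIndepFun Z μ)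
    (hident : ∀ i, IdentDistrib (Z i) (Z 0) μ μ) (hreg : IsRegularAt g Θ θ₀ P)
    (hQ : μ.map (Z 0) =
      (P.withDensity fun t => ENNReal.ofReal (g t θ₀)).map (fun t => (t, (1 : ℝ))) +
      (P.withDensity fun t => ENNReal.ofReal (1 - g t θ₀)).map (fun t => (t, (0 : ℝ))))
    {J : Param p ≃L[ℝ] Param p}
    (hJ : (J : Param p →L[ℝ] Param p) = ∫ z, fderiv ℝ (score g z.1 z.2) θ₀ ∂(μ.map (Z 0)))
    {B : Param p →L[ℝ] ℝ} (hB : B = ∫ z, fderiv ℝ (g z.1) θ₀ ∂(μ.map (Z 0)))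
    {r : ℕ → ℕ} {γ : ℝ} (hγ : 0 < γ)
    (hrγ : Tendsto (fun n => (r n : ℝ) / (n : ℝ)) atTop (𝓝 γ))
    (huniq : Tendsto (fun n => μ {ω | ¬ Set.Subsingleton {ϑ ∈ Θ |
      IsLabeledRoot g (r n) (fun i => (Z i ω).1) (fun i => (Z i ω).2) ϑ}}) atTop (𝓝 0))
    {θhat : ℕ → Ω → Param p}
    (hroot : ∀ n ω, (∃ ϑ ∈ Θ,
        IsLabeledRoot g (r n) (fun i => (Z i ω).1) (fun i => (Z i ω).2) ϑ) →
      θhat n ω ∈ Θ ∧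
        IsLabeledRoot g (r n) (fun i => (Z i ω).1) (fun i => (Z i ω).2) (θhat n ω)) :
    TendstoInMeasure μ (fun (n : ℕ) ω => √(n : ℝ) *
      (priorEstimate g n (fun i => (Z i ω).1) (θhat n ω)
        - (n : ℝ)⁻¹ • ∑ i ∈ Finset.range n, g (Z i ω).1 θ₀
        + B (J.symm ((r n : ℝ)⁻¹ • ∑ i ∈ Finset.range (r n), score g (Z i ω).1 (Z i ω).2 θ₀))))
      atTop (fun _ => 0) := by
  have hpm : IsProbabilityMeasure (μ.map (Z 0)) :=
    Measure.isProbabilityMeasure_map (hident 0).aemeasurable_fst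
  have hπ := measurable_section hreg.measurable θ₀
  have hrtop : Tendsto r atTop atTop := by
    rw [← tendsto_natCast_atTop_iff (R := ℝ)]
    refine (hrγ.pos_mul_atTop hγ tendsto_natCast_atTop_atTop).congr' ?_
    filter_upwards [eventually_gt_atTop 0] with n hn
    have : (n : ℝ) ≠ 0 := by exact_mod_cast hn.ne'
    field_simp
  rw [tendstoInMeasure_iff_measureReal_norm]
  intro η hη
  rw [Metric.tendsto_nhds]
  intro e he
  -- The added 1 keeps `K` positive even for `p = 0`, where the inverse has norm 0.
  set K : ℝ := ‖(J.symm : Param p →L[ℝ] Param p)‖ + 1 with hKdef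
  have hK : 0 < K := by positivity
  have hJK : ∀ v, ‖J.symm v‖ ≤ K * ‖v‖ := fun v =>
    ((J.symm : Param p →L[ℝ] Param p).le_opNorm v).trans (by gcongr; linarith)
  set C' : ℝ := 2 * K * (1 + ‖B‖ * K) with hC'def
  have hC' : 0 < C' := by positivity
  set C : ℝ := ∑ a, ∫ z, score g z.1 z.2 θ₀ a ^ 2 ∂(μ.map (Z 0)) with hCdef
  -- The last quantity is the limit of the Chebyshev bound on the probability that `√n ε C'` times
  -- the norm of the score average reaches `η`. It is the only bound that does not vanish as `n`
  -- grows.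
  obtain ⟨ε, hε, hεK, hεe⟩ : ∃ ε : ℝ, 0 < ε ∧ ε * K ≤ 1 / 2 ∧
      γ⁻¹ * C * (ε * C') ^ 2 / η ^ 2 < e := by
    have h1 : Tendsto (fun ε : ℝ => ε * K) (𝓝[>] 0) (𝓝 (0 * K)) :=
      ((continuous_id.mul continuous_const).tendsto 0).mono_left nhdsWithin_le_nhds
    have h2 : Tendsto (fun ε : ℝ => γ⁻¹ * C * (ε * C') ^ 2 / η ^ 2) (𝓝[>] 0)
        (𝓝 (γ⁻¹ * C * (0 * C') ^ 2 / η ^ 2)) :=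
      ((by fun_prop : Continuous fun ε : ℝ => γ⁻¹ * C * (ε * C') ^ 2 / η ^ 2).tendsto 0).mono_left
        nhdsWithin_le_nhds
    have h1' := h1.eventually_le_const (u := 1 / 2) (by norm_num)
    have h2' := h2.eventually_lt_const (u := e) (by simpa using he)
    obtain ⟨ε, ⟨h3, h4⟩, h5⟩ := ((h1'.and h2').and self_mem_nhdsWithin).exists
    exact ⟨ε, h5, h3, h4⟩
  lift ε to ℝ≥0 using hε.le
  obtain ⟨U, hU, hθ, hUΘ, hC2, M, hM, hb⟩ := hreg.smooth
  have hMQ := integrable_comp_fst_add_withDensity hπ hreg.ae_mem_Icc hQ hM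
  have hsc : ∀ y : ℝ, ∀ᵐ t ∂P, ContDiffOn ℝ 1 (score g t y) U := fun y => by
    filter_upwards [hC2, hreg.mem_Ioo] with t ht h01
    exact contDiffOn_score hU ht (fun ϑ hϑ => h01 ϑ (hUΘ hϑ)) y
  obtain ⟨δ₁, hδ₁, hδU, hE1⟩ := exists_tendsto_approximatesLinearOn_average hindep hident
    (F := fun z => score g z.1 z.2) hU hθ
    (fun ϑ hϑ => aestronglyMeasurable_score hQ hreg.measurable hU hC2 hϑ)
    (ae_add_withDensity hQ (hsc 1) (hsc 0)) hMQ
    (ae_add_withDensity hQ (hb.mono fun t ht ϑ hϑ => (ht ϑ hϑ).2 1 (by simp))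
      (hb.mono fun t ht ϑ hϑ => (ht ϑ hϑ).2 0 (by simp))) (NNReal.coe_pos.1 hε)
  have hg1 : ∀ᵐ t ∂P, ContDiffOn ℝ 1 (g t) U := hC2.mono fun t ht => ht.of_le (by norm_num)
  have hgb : ∀ᵐ t ∂P, ∀ ϑ ∈ U, ‖fderiv ℝ (g t) ϑ‖ ≤ M t := hb.mono fun t ht ϑ hϑ => by
    rw [← norm_gradient]; exact (ht ϑ hϑ).1
  obtain ⟨δ₂, hδ₂, -, hE2⟩ := exists_tendsto_approximatesLinearOn_average hindep hident
    (F := fun z => g z.1) hU hθ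
    (fun ϑ _ => ((measurable_section hreg.measurable ϑ).comp measurable_fst).aestronglyMeasurable)
    (ae_add_withDensity hQ hg1 hg1) hMQ (ae_add_withDensity hQ hgb hgb) (NNReal.coe_pos.1 hε)
  rw [← hJ] at hE1
  rw [← hB] at hE2
  set δ := min δ₁ δ₂ with hδdef
  have hδ : 0 < δ := lt_min hδ₁ hδ₂
  have toReal : ∀ {s : ℕ → Set Ω}, Tendsto (fun n => μ (s n)) atTop (𝓝 0) →
      Tendsto (fun n => μ.real (s n)) atTop (𝓝 0) := fun h =>
    (ENNReal.tendsto_toReal ENNReal.zero_ne_top).comp h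
  have hE1' := toReal (hE1.comp hrtop)
  have hE2' := toReal hE2
  have hE3' := toReal huniq
  have hrinv : Tendsto (fun n => (r n : ℝ)⁻¹) atTop (𝓝 0) :=
    tendsto_inv_atTop_zero.comp (tendsto_natCast_atTop_atTop.comp hrtop)
  have hlim : Tendsto (fun n => (r n : ℝ)⁻¹ * C / (δ / (2 * K)) ^ 2 +
      ((r n : ℝ) / n)⁻¹ * C * (ε * C') ^ 2 / η ^ 2) atTop
      (𝓝 (0 * C / (δ / (2 * K)) ^ 2 + γ⁻¹ * C * (ε * C') ^ 2 / η ^ 2)) :=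
    ((hrinv.mul_const C).div_const _).add
      ((((hrγ.inv₀ hγ.ne').mul_const C).mul_const _).div_const _)
  have hsum := ((hE1'.add hE2').add hE3').add hlim
  have hlt := hsum.eventually_lt_const (u := e) (by simpa using hεe)
  filter_upwards [hlt, eventually_gt_atTop 0, hrtop.eventually_gt_atTop 0] with n hn hn0 hr0
  have hn' : (0 : ℝ) < n := by exact_mod_cast hn0
  have hsn : 0 < √(n : ℝ) := Real.sqrt_pos.2 hn'
  rw [Real.dist_0_eq_abs, abs_of_nonneg measureReal_nonneg]
  refine lt_of_le_of_lt ?_ hn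
  have hscore := hreg.memLp_score hQ
  have hscore0 := hreg.integral_score hQ
  have hE4 := measureReal_le_norm_sum hindep hident (F := fun z => score g z.1 z.2 θ₀) hscore
    hscore0 (r n) (η := δ / (2 * K)) (by positivity)
  have hE5 := measureReal_le_norm_sum hindep hident (F := fun z => score g z.1 z.2 θ₀) hscore
    hscore0 (r n) (η := η / (√(n : ℝ) * (ε * C'))) (by positivity)
  have e5 : (r n : ℝ)⁻¹ * C / (η / (√(n : ℝ) * (ε * C'))) ^ 2 =
      ((r n : ℝ) / n)⁻¹ * C * (ε * C') ^ 2 / η ^ 2 := by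
    rw [div_pow, mul_pow, Real.sq_sqrt hn'.le]
    have : (r n : ℝ) ≠ 0 := by exact_mod_cast hr0.ne'
    field_simp
  rw [e5] at hE5
  -- Five exceptional events: either average fails to be nearly linear, the root is not unique, or
  -- the score average at `θ₀` is too large for the root to stay in the ball or for the error to
  -- stay below `η`.
  refine le_trans ?_ (add_le_add le_rfl (add_le_add hE4 hE5))
  refine le_trans (measureReal_mono ?_) ((measureReal_union_le _ _).trans (add_le_add
    ((measureReal_union_le _ _).trans (add_le_add (measureReal_union_le _ _) le_rfl))
    (measureReal_union_le _ _)))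
  intro ω hω
  by_contra hcon
  simp only [Set.mem_union, Set.mem_ofPred_eq, not_or, not_not, not_le, sub_zero,
    Real.norm_eq_abs] at hcon hω
  obtain ⟨⟨⟨c1, c2⟩, c3⟩, c4, c5⟩ := hcon
  have hsub1 := Metric.closedBall_subset_closedBall (x := θ₀) (min_le_left δ₁ δ₂)
  have hsub2 := Metric.closedBall_subset_closedBall (x := θ₀) (min_le_right δ₁ δ₂)
  rw [lt_div_iff₀ (by positivity)] at c4 c5
  have := abs_priorEstimate_sub_add_le (x := fun i => (Z i ω).1) (y := fun i => (Z i ω).2)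
    (c1.mono_set hsub1) (c2.mono_set hsub2) hK hJK hεK ((hsub1.trans hδU).trans hUΘ) hr0
    (by linarith) c3 (hroot n ω)
  rw [abs_mul, abs_of_pos hsn] at hω
  have h2 := mul_le_mul_of_nonneg_left this hsn.le
  rw [← hC'def] at h2
  linarith

end Remainder

end PriorEstimation

namespace PriorEstimation

/-! ### Population matrices and the linear term -/

section Population

variable {f p : ℕ} {g : Feature f → Param p → ℝ} {Θ : Set (Param p)} {θ₀ : Param p}
  {P : Measure (Feature f)} {Q : Measure (Feature f × ℝ)}

section Joint

variable (hQ : Q = (P.withDensity fun t => ENNReal.ofReal (g t θ₀)).map (fun t => (t, (1 : ℝ))) +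
  (P.withDensity fun t => ENNReal.ofReal (1 - g t θ₀)).map (fun t => (t, (0 : ℝ))))

include hQ

theorem exists_equiv_integral_fderiv_score (hreg : IsRegularAt g Θ θ₀ P)
    {A : Matrix (Fin p) (Fin p) ℝ}
    (hA : ∀ a b, A a b =
      ∫ t, weight g t θ₀ * gradient (g t) θ₀ a * gradient (g t) θ₀ b ∂P) (hdet : A.det ≠ 0) :
    ∃ J : Param p ≃L[ℝ] Param p,
      (J : Param p →L[ℝ] Param p) = ∫ z, fderiv ℝ (score g z.1 z.2) θ₀ ∂Q ∧
      ∀ v, J.symm v = -WithLp.toLp 2 (A⁻¹ *ᵥ v.ofLp) := by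
  have hu : IsUnit A.det := hdet.isUnit
  set D : Param p →L[ℝ] Param p := ∫ z, fderiv ℝ (score g z.1 z.2) θ₀ ∂Q with hD
  have hDv : ∀ v, D v = -WithLp.toLp 2 (A *ᵥ v.ofLp) := by
    intro v
    ext a
    rw [hD, integral_fderiv_score_apply hQ hreg v a]
    simp only [PiLp.neg_apply, Matrix.mulVec, dotProduct, hA]
  let R : Param p →L[ℝ] Param p :=
    -LinearMap.toContinuousLinearMap (Matrix.toEuclideanLin A⁻¹)
  have hRv : ∀ v, R v = -WithLp.toLp 2 (A⁻¹ *ᵥ v.ofLp) := fun v => rfl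
  refine ⟨ContinuousLinearEquiv.equivOfInverse D R (fun v => ?_) (fun v => ?_), rfl, hRv⟩
  · rw [hRv, hDv]
    simp [Matrix.mulVec_neg, Matrix.mulVec_mulVec, Matrix.nonsing_inv_mul A hu]
  · rw [hDv, hRv]
    simp [Matrix.mulVec_neg, Matrix.mulVec_mulVec, Matrix.mul_nonsing_inv A hu]

theorem memLp_sum_mul_score (hreg : IsRegularAt g Θ θ₀ P) (c : Fin p → ℝ) :
    MemLp (fun z : Feature f × ℝ => ∑ a, c a * score g z.1 z.2 θ₀ a) 2 Q :=
  memLp_finsetSum _ fun a _ => (hreg.memLp_score hQ a).const_mul _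

theorem integral_mul_sum_mul_score [IsFiniteMeasure Q] (hreg : IsRegularAt g Θ θ₀ P)
    (c : Fin p → ℝ) {φ : Feature f → ℝ} (hφ : MemLp (fun z : Feature f × ℝ => φ z.1) 2 Q) :
    ∫ z : Feature f × ℝ, φ z.1 * ∑ a, c a * score g z.1 z.2 θ₀ a ∂Q = 0 := by
  simp_rw [Finset.mul_sum, mul_left_comm]
  have hi : ∀ a, Integrable (fun z : Feature f × ℝ => φ z.1 * score g z.1 z.2 θ₀ a) Q := fun a =>
    hφ.integrable_mul (hreg.memLp_score hQ a)
  rw [integral_finsetSum _ fun a _ => (hi a).const_mul _]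
  refine Finset.sum_eq_zero fun a _ => ?_
  rw [integral_const_mul, hreg.integral_mul_score hQ hφ, mul_zero]

theorem integral_sum_mul_score_sq (hreg : IsRegularAt g Θ θ₀ P)
    {A : Matrix (Fin p) (Fin p) ℝ}
    (hA : ∀ a b, A a b =
      ∫ t, weight g t θ₀ * gradient (g t) θ₀ a * gradient (g t) θ₀ b ∂P) (c : Fin p → ℝ) :
    ∫ z : Feature f × ℝ, (∑ a, c a * score g z.1 z.2 θ₀ a) ^ 2 ∂Q = c ⬝ᵥ (A *ᵥ c) := by
  have e : ∀ z : Feature f × ℝ, (∑ a, c a * score g z.1 z.2 θ₀ a) ^ 2 =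
      ∑ a, ∑ b, (c a * c b) * (score g z.1 z.2 θ₀ a * score g z.1 z.2 θ₀ b) := fun z => by
    rw [sq, Finset.sum_mul_sum]
    exact Finset.sum_congr rfl fun a _ => Finset.sum_congr rfl fun b _ => by ring
  simp_rw [e]
  have hi := fun a b => (hreg.integrable_score_mul_score hQ a b).const_mul (c a * c b)
  rw [integral_finsetSum _ fun a _ => integrable_finsetSum _ fun b _ => hi a b]
  simp only [dotProduct, Matrix.mulVec, Finset.mul_sum]
  refine Finset.sum_congr rfl fun a _ => ?_
  rw [integral_finsetSum _ fun b _ => hi a b]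
  refine Finset.sum_congr rfl fun b _ => ?_
  rw [integral_const_mul, hreg.integral_score_mul_score hQ, ← hA]
  ring

end Joint

theorem integrable_fderiv_section (hreg : IsRegularAt g Θ θ₀ P) :
    Integrable (fun t => fderiv ℝ (g t) θ₀) P := by
  obtain ⟨U, hU, hθ, hUΘ, hC, M, hM, hb⟩ := hreg.smooth
  refine hM.mono' (aestronglyMeasurable_fderiv hU hθ
    (fun ϑ _ => (measurable_section hreg.measurable ϑ).aestronglyMeasurable) ?_) ?_
  · exact hC.mono fun t ht => (ht.differentiableOn two_ne_zero).differentiableAt (hU.mem_nhds hθ)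
  · exact hb.mono fun t ht => norm_gradient (g t) θ₀ ▸ (ht θ₀ hθ).1

theorem integral_fderiv_apply_eq_dotProduct (hreg : IsRegularAt g Θ θ₀ P) {B : Fin p → ℝ}
    (hB : ∀ a, B a = ∫ t, gradient (g t) θ₀ a ∂P) (v : Param p) :
    (∫ t, fderiv ℝ (g t) θ₀ ∂P) v = B ⬝ᵥ v.ofLp := by
  obtain ⟨U, hU, hθ, hUΘ, hC, M, hM, hb⟩ := hreg.smooth
  have hgr : Integrable (fun t => gradient (g t) θ₀) P :=
    hM.mono' hreg.aestronglyMeasurable_gradient (hb.mono fun t ht => (ht θ₀ hθ).1)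
  have hint := integrable_fderiv_section hreg
  have hia : ∀ a, Integrable (fun t => gradient (g t) θ₀ a) P := fun a =>
    (EuclideanSpace.proj (𝕜 := ℝ) a).integrable_comp hgr
  rw [ContinuousLinearMap.integral_apply hint]
  simp_rw [fderiv_apply_eq_sum_gradient]
  rw [integral_finsetSum _ fun a _ => (hia a).mul_const _]
  simp_rw [integral_mul_const, ← hB, dotProduct]

end Population

section Terms

variable {Ω : Type*} [MeasurableSpace Ω] {μ : Measure Ω} {f p : ℕ}
  {g : Feature f → Param p → ℝ} {X : ℕ → Ω → Feature f} {Y : ℕ → Ω → ℝ} {θ₀ : Param p}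

theorem labeledScoreTerm_eq_sum (r : ℕ) (ω : Ω) :
    labeledScoreTerm μ g X Y θ₀ r ω = (1 / (r : ℝ)) * ∑ i ∈ Finset.range r,
      ∑ a, (vecB μ g (X 0) θ₀ ᵥ* (matA μ g (X 0) θ₀)⁻¹) a * score g (X i ω) (Y i ω) θ₀ a := by
  rw [labeledScoreTerm, Matrix.dotProduct_mulVec, Finset.sum_comm]
  simp only [dotProduct, Finset.mul_sum]

theorem labeledScoreTerm_eq_dotProduct (r : ℕ) (ω : Ω) :
    labeledScoreTerm μ g X Y θ₀ r ω = vecB μ g (X 0) θ₀ ⬝ᵥ ((matA μ g (X 0) θ₀)⁻¹ *ᵥ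
      ((r : ℝ)⁻¹ • ∑ i ∈ Finset.range r, score g (X i ω) (Y i ω) θ₀ : Param p).ofLp) := by
  rw [WithLp.ofLp_smul, Matrix.mulVec_smul, dotProduct_smul, labeledScoreTerm, one_div, smul_eq_mul,
    WithLp.ofLp_sum]
  congr 3
  congr 1 with a
  rw [Finset.sum_apply]

/-- `A` is symmetric, so the coefficient vector of the labeled-score term is `A⁻¹ B`, and one factor
`A` cancels in its quadratic form. -/
theorem vecMul_inv_dotProduct_mulVec (hA : (matA μ g (X 0) θ₀).det ≠ 0) :
    (vecB μ g (X 0) θ₀ ᵥ* (matA μ g (X 0) θ₀)⁻¹) ⬝ᵥ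
      (matA μ g (X 0) θ₀ *ᵥ (vecB μ g (X 0) θ₀ ᵥ* (matA μ g (X 0) θ₀)⁻¹)) =
      quadBAB μ g (X 0) θ₀ := by
  set A := matA μ g (X 0) θ₀ with hAdef
  have hu : IsUnit A.det := hA.isUnit
  have hT : Aᵀ = A := matA_transpose
  have h1 : vecB μ g (X 0) θ₀ ᵥ* A⁻¹ = A⁻¹ *ᵥ vecB μ g (X 0) θ₀ := by
    rw [← Matrix.vecMul_transpose, Matrix.transpose_nonsing_inv, hT]
  rw [h1, Matrix.mulVec_mulVec, Matrix.mul_nonsing_inv A hu, Matrix.one_mulVec, dotProduct_comm]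
  rfl

end Terms

/-- Slutsky with a deterministic normalization converging to the limiting standard deviation. -/
theorem tendstoInDistribution_div_sqrt {Ω : Type*} [MeasurableSpace Ω] {μ : Measure Ω}
    [IsProbabilityMeasure μ] {T : ℕ → Ω → ℝ} {s : ℝ} (hs : 0 < s)
    (hT : TendstoInDistribution T atTop (id : ℝ → ℝ) (fun _ => μ) (gaussianReal 0 s.toNNReal))
    {a : ℕ → ℝ} (ha : Tendsto a atTop (𝓝 s)) :
    TendstoInDistribution (fun n ω => T n ω * (√(a n))⁻¹) atTop (id : ℝ → ℝ) (fun _ => μ)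
      (gaussianReal 0 1) := by
  have hsq : √s ≠ 0 := (Real.sqrt_pos.2 hs).ne'
  have hlim : Tendsto (fun n => (√(a n))⁻¹) atTop (𝓝 (√s)⁻¹) :=
    ((Real.continuous_sqrt.tendsto s).comp ha).inv₀ hsq
  have hc : TendstoInMeasure μ (fun n (_ : Ω) => (√(a n))⁻¹) atTop (fun _ => (√s)⁻¹) :=
    tendstoInMeasure_of_tendsto_ae (fun _ => aestronglyMeasurable_const) (ae_of_all _ fun _ => hlim)
  have h := hT.continuous_comp_prodMk_of_tendstoInMeasure_const
    (g := fun x : ℝ × ℝ => x.1 * x.2) (by fun_prop) hc (fun _ => aemeasurable_const)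
  have hlaw : (gaussianReal 0 s.toNNReal).map (fun x => id x * (√s)⁻¹) =
      (gaussianReal 0 1).map id := by
    simp only [id]
    rw [gaussianReal_map_mul_const, Measure.map_id, mul_zero]
    congr 1
    ext
    simp only [NNReal.coe_mul, NNReal.coe_mk, inv_pow, NNReal.coe_one, Real.sq_sqrt hs.le,
      Real.coe_toNNReal s hs.le]
    exact inv_mul_cancel₀ hs.ne'
  refine ⟨h.forall_aemeasurable, by fun_prop, ?_⟩
  have ht := h.tendsto
  simp only [hlaw] at ht
  exact ht

end PriorEstimation

/-! ### Asymptotic normality of the prior estimate -/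

theorem mainTheorem2 {Ω : Type*} [MeasurableSpace Ω] (μ : Measure Ω) [IsProbabilityMeasure μ]
    {c f p : ℕ}
    -- the i.i.d. observations: feature vectors and 0-1 class vectors
    (X : ℕ → Ω → PriorEstimation.Feature f) (Y : ℕ → Ω → Fin c → ℝ)
    (hX : ∀ i, Measurable (X i)) (hY : ∀ i, Measurable (Y i))
    (hY01 : ∀ i ω k, Y i ω k = 0 ∨ Y i ω k = 1)
    (hindep : iIndepFun (fun i ω => (X i ω, Y i ω)) μ)
    (hident : ∀ i, IdentDistrib (fun ω => (X i ω, Y i ω)) (fun ω => (X 0 ω, Y 0 ω)) μ μ)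
    -- the first `r n` of the `n` observations are labeled
    (r : ℕ → ℕ) (hr : ∀ n, r n ≤ n) (γ : ℝ) (hγ : 0 < γ)
    (hrγ : Tendsto (fun n => (r n : ℝ) / (n : ℝ)) atTop (𝓝 γ))
    -- the parametric model for the class membership probability of class `j`
    (g : PriorEstimation.Feature f → PriorEstimation.Param p → ℝ)
    (Θ : Set (PriorEstimation.Param p)) (θ : Fin c → PriorEstimation.Param p) (j : Fin c)
    (hmodel : μ⟦{ω | Y 0 ω j = 1} | MeasurableSpace.comap (X 0) inferInstance⟧
      =ᵐ[μ] fun ω => g (X 0 ω) (θ j))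
    (hreg : PriorEstimation.IsRegularAt g Θ (θ j) (μ.map (X 0)))
    (hA : (PriorEstimation.matA μ g (X 0) (θ j)).det ≠ 0)
    -- with probability tending to one, the estimating equation has at most one root in `Θ`
    (huniq : Tendsto (fun n => μ {ω | ¬ Set.Subsingleton {ϑ ∈ Θ |
      PriorEstimation.IsLabeledRoot g (r n) (fun i => X i ω) (fun i => Y i ω j) ϑ}})
      atTop (𝓝 0))
    -- the estimator is a root of the estimating equation whenever there is one in `Θ`
    (θhat : ℕ → Ω → PriorEstimation.Param p) (hθmeas : ∀ n, Measurable (θhat n))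
    (hroot : ∀ n ω, (∃ ϑ ∈ Θ,
        PriorEstimation.IsLabeledRoot g (r n) (fun i => X i ω) (fun i => Y i ω j) ϑ) →
      θhat n ω ∈ Θ ∧
        PriorEstimation.IsLabeledRoot g (r n) (fun i => X i ω) (fun i => Y i ω j) (θhat n ω))
    (q : ℝ) (hq : q = ∫ ω, Y 0 ω j ∂μ)
    (qhat : ℕ → Ω → ℝ)
    (hqhat : ∀ n ω, qhat n ω = PriorEstimation.priorEstimate g n (fun i => X i ω) (θhat n ω))
    (L S : ℕ → Ω → ℝ)
    (hL : ∀ n ω, L n ω = PriorEstimation.fullSampleTerm g X (θ j) q n ω)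
    (hS : ∀ n ω, S n ω =
      PriorEstimation.labeledScoreTerm μ g X (fun i ω => Y i ω j) (θ j) (r n) ω)
    (σ2 : ℝ)
    (hσ2 : σ2 = Var[fun ω => g (X 0 ω) (θ j); μ]
      + γ⁻¹ * PriorEstimation.quadBAB μ g (X 0) (θ j)) :
    -- asymptotic normality of the estimator, with the stated asymptotic variance
    (0 ≤ σ2 ∧
      Tendsto (fun n : ℕ => (n : ℝ) * PriorEstimation.avar μ g (X 0) (θ j) n (r n))
        atTop (𝓝 σ2) ∧
      TendstoInDistribution (fun (n : ℕ) ω => √(n : ℝ) * (qhat n ω - q)) atTop (id : ℝ → ℝ)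
        (fun _ => μ) (gaussianReal 0 σ2.toNNReal)) ∧
    (0 < σ2 →
      TendstoInDistribution
        (fun (n : ℕ) ω =>
          (qhat n ω - q) / √(PriorEstimation.avar μ g (X 0) (θ j) n (r n)))
        atTop (id : ℝ → ℝ) (fun _ => μ) (gaussianReal 0 1)) ∧
    -- the estimation error is, up to `o_P(n^{-1/2})`, a sum of two uncorrelated terms whose
    -- variances are the two summands of the asymptotic variance
    TendstoInMeasure μ (fun (n : ℕ) ω => √(n : ℝ) * (qhat n ω - q - (L n ω + S n ω))) atTop
      (fun _ => 0) ∧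
    (∀ n, 0 < r n →
      MemLp (L n) 2 μ ∧ MemLp (S n) 2 μ ∧ cov[L n, S n; μ] = 0 ∧
      Var[L n; μ] = (1 / (n : ℝ)) * Var[fun ω => g (X 0 ω) (θ j); μ] ∧
      Var[S n; μ] = (1 / (r n : ℝ)) * PriorEstimation.quadBAB μ g (X 0) (θ j)) := by
  have hYj : ∀ i, Measurable fun ω => Y i ω j := fun i => (measurable_pi_apply j).comp (hY i)
  have hpair : Measurable fun z : PriorEstimation.Feature f × (Fin c → ℝ) => (z.1, z.2 j) := by
    fun_prop
  set Z : ℕ → Ω → PriorEstimation.Feature f × ℝ := fun i ω => (X i ω, Y i ω j) with hZdef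
  have hZindep : iIndepFun Z μ := hindep.comp (fun _ z => (z.1, z.2 j)) fun _ => hpair
  have hZident : ∀ i, IdentDistrib (Z i) (Z 0) μ μ := fun i => (hident i).comp hpair
  have hZm : ∀ i, AEMeasurable (Z i) μ := fun i => (hZident i).aemeasurable_fst
  have hpm : IsProbabilityMeasure (μ.map (Z 0)) := Measure.isProbabilityMeasure_map (hZm 0)
  have hπ := PriorEstimation.measurable_section hreg.measurable (θ j)
  have hQ := PriorEstimation.map_pair_eq_add_withDensity (hX 0) (hYj 0) (fun ω => hY01 0 ω j) hπ
    hreg.ae_mem_Icc hmodel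
  change μ.map (Z 0) = _ at hQ
  set θ₀ := θ j with hθ₀
  set P := μ.map (X 0) with hP
  have hPm : IsProbabilityMeasure P := Measure.isProbabilityMeasure_map (hX 0).aemeasurable
  set A := PriorEstimation.matA μ g (X 0) θ₀ with hAdef
  have hAP := PriorEstimation.matA_apply_map (hX 0).aemeasurable hreg
  have hBP := PriorEstimation.vecB_apply_map (hX 0).aemeasurable hreg
  have hgbd : ∀ᵐ t ∂P, ‖g t θ₀‖ ≤ 1 := by
    filter_upwards [hreg.ae_mem_Icc] with t ht
    rw [Real.norm_of_nonneg ht.1]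
    exact ht.2
  have hgint : Integrable (fun t => g t θ₀) P := Integrable.of_bound hπ.aestronglyMeasurable 1 hgbd
  have hqg : q = ∫ t, g t θ₀ ∂P := by
    have hyint : Integrable (fun z : PriorEstimation.Feature f × ℝ => z.2) (μ.map (Z 0)) := by
      refine Integrable.of_bound measurable_snd.aestronglyMeasurable 1 ?_
      exact PriorEstimation.ae_add_withDensity hQ (by simp) (by simp)
    have h1 : ∫ ω, Y 0 ω j ∂μ = ∫ z, z.2 ∂(μ.map (Z 0)) :=
      (integral_map (hZm 0) hyint.aestronglyMeasurable).symm
    rw [hq, h1, PriorEstimation.integral_add_withDensity hπ hreg.ae_mem_Icc hQ hyint]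
    simp
  -- `L n` averages `u` over all `n` pairs and `S n` averages `v` over the labeled ones. As `u`
  -- depends on the features alone, it is orthogonal to `v`.
  set u : PriorEstimation.Feature f × ℝ → ℝ := fun z => g z.1 θ₀ - q with hudef
  set cf : Fin p → ℝ := PriorEstimation.vecB μ g (X 0) θ₀ ᵥ* A⁻¹ with hcf
  set v : PriorEstimation.Feature f × ℝ → ℝ :=
    fun z => ∑ a, cf a * PriorEstimation.score g z.1 z.2 θ₀ a with hvdef
  have hu : MemLp u 2 (μ.map (Z 0)) := by
    refine MemLp.sub (MemLp.of_bound (hπ.comp measurable_fst).aestronglyMeasurable 1 ?_)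
      (memLp_const q)
    exact PriorEstimation.ae_add_withDensity hQ hgbd hgbd
  have hv : MemLp v 2 (μ.map (Z 0)) := PriorEstimation.memLp_sum_mul_score hQ hreg cf
  have hgintQ : Integrable (fun z : PriorEstimation.Feature f × ℝ => g z.1 θ₀) (μ.map (Z 0)) :=
    PriorEstimation.integrable_comp_fst_add_withDensity hπ hreg.ae_mem_Icc hQ hgint
  have hgQ : ∫ z, g z.1 θ₀ ∂(μ.map (Z 0)) = q := by
    rw [hqg]
    exact PriorEstimation.integral_comp_fst_add_withDensity hπ hreg.ae_mem_Icc hQ hgint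
  have hu0 : ∫ z, u z ∂(μ.map (Z 0)) = 0 := by
    rw [hudef, integral_sub hgintQ (integrable_const q), hgQ]
    simp
  have huv : ∫ z, u z * v z ∂(μ.map (Z 0)) = 0 :=
    PriorEstimation.integral_mul_sum_mul_score hQ hreg cf (φ := fun t => g t θ₀ - q) hu
  have hv0 : ∫ z, v z ∂(μ.map (Z 0)) = 0 := by
    simpa using PriorEstimation.integral_mul_sum_mul_score hQ hreg cf (φ := fun _ => 1)
      (memLp_const 1)
  have hum := hu.aestronglyMeasurable.aemeasurable
  have hvm := hv.aestronglyMeasurable.aemeasurable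
  have hVu : Var[u; μ.map (Z 0)] = Var[fun ω => g (X 0 ω) θ₀; μ] := by
    rw [hudef, variance_sub_const hgintQ.aestronglyMeasurable]
    exact variance_map (X := fun z : PriorEstimation.Feature f × ℝ => g z.1 θ₀)
      hgintQ.aestronglyMeasurable.aemeasurable (hZm 0)
  have hVu2 : ∫ z, u z ^ 2 ∂(μ.map (Z 0)) = Var[fun ω => g (X 0 ω) θ₀; μ] := by
    rw [← hVu, variance_of_integral_eq_zero hum hu0]
  have hv2 : ∫ z, v z ^ 2 ∂(μ.map (Z 0)) = PriorEstimation.quadBAB μ g (X 0) θ₀ := by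
    rw [hvdef, PriorEstimation.integral_sum_mul_score_sq hQ hreg hAP cf]
    exact PriorEstimation.vecMul_inv_dotProduct_mulVec hA
  have hVv : Var[v; μ.map (Z 0)] = PriorEstimation.quadBAB μ g (X 0) θ₀ := by
    rw [← hv2, variance_of_integral_eq_zero hvm hv0]
  have hcuv : cov[u, v; μ.map (Z 0)] = 0 := by
    rw [covariance_eq_sub hu hv, hu0, zero_mul, sub_zero]
    exact huv
  have hquad : 0 ≤ PriorEstimation.quadBAB μ g (X 0) θ₀ := by rw [← hVv]; exact variance_nonneg _ _
  have hσ0 : 0 ≤ σ2 := by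
    rw [hσ2]
    have := variance_nonneg (fun ω => g (X 0 ω) θ₀) μ
    positivity
  have hLeq : ∀ n, L n = fun ω => (1 / (n : ℝ)) * ∑ i ∈ Finset.range n, u (Z i ω) := fun n =>
    funext fun ω => hL n ω
  have hSeq : ∀ n, S n = fun ω => (1 / (r n : ℝ)) * ∑ i ∈ Finset.range (r n), v (Z i ω) := fun n =>
    funext fun ω => (hS n ω).trans (PriorEstimation.labeledScoreTerm_eq_sum (r n) ω)
  have hLm : ∀ n, MemLp (L n) 2 μ := fun n => by
    rw [hLeq]
    exact (memLp_finsetSum _ fun i _ =>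
      PriorEstimation.memLp_comp_of_identDistrib hZident hu i).const_mul _
  have hSm : ∀ n, MemLp (S n) 2 μ := fun n => by
    rw [hSeq]
    exact (memLp_finsetSum _ fun i _ =>
      PriorEstimation.memLp_comp_of_identDistrib hZident hv i).const_mul _
  -- the linear expansion
  have hrem : TendstoInMeasure μ (fun (n : ℕ) ω => √(n : ℝ) * (qhat n ω - q - (L n ω + S n ω)))
      atTop (fun _ => 0) := by
    obtain ⟨J, hJ, hJs⟩ := PriorEstimation.exists_equiv_integral_fderiv_score hQ hreg hAP hA
    have h := PriorEstimation.tendstoInMeasure_remainder hZindep hZident hreg hQ hJ rfl hγ hrγ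
      huniq hroot
    refine h.congr_left fun n => ae_of_all _ fun ω => ?_
    rcases Nat.eq_zero_or_pos n with rfl | hn
    · simp
    have hn' : (n : ℝ) ≠ 0 := by exact_mod_cast hn.ne'
    have hB : (∫ z : PriorEstimation.Feature f × ℝ, fderiv ℝ (g z.1) θ₀ ∂(μ.map (Z 0))) =
        ∫ t, fderiv ℝ (g t) θ₀ ∂P :=
      PriorEstimation.integral_comp_fst_add_withDensity hπ hreg.ae_mem_Icc hQ
        (PriorEstimation.integrable_fderiv_section hreg)
    -- The minus sign is absorbed by `J⁻¹ = -A⁻¹`.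
    have hSn : S n ω = -(∫ z : PriorEstimation.Feature f × ℝ, fderiv ℝ (g z.1) θ₀ ∂(μ.map (Z 0)))
        (J.symm ((r n : ℝ)⁻¹ • ∑ i ∈ Finset.range (r n),
          PriorEstimation.score g (Z i ω).1 (Z i ω).2 θ₀)) := by
      rw [hS, PriorEstimation.labeledScoreTerm_eq_dotProduct, hB,
        PriorEstimation.integral_fderiv_apply_eq_dotProduct hreg hBP, hJs, WithLp.ofLp_neg,
        dotProduct_neg, neg_neg]
    have hLn : L n ω = (n : ℝ)⁻¹ • ∑ i ∈ Finset.range n, g (Z i ω).1 θ₀ - q := by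
      rw [hL, PriorEstimation.fullSampleTerm, Finset.sum_sub_distrib]
      simp only [Finset.sum_const, Finset.card_range, nsmul_eq_mul, smul_eq_mul]
      field_simp
      rfl
    change _ = √(n : ℝ) * (qhat n ω - q - (L n ω + S n ω))
    have hqn : qhat n ω =
        PriorEstimation.priorEstimate g n (fun i => (Z i ω).1) (θhat n ω) := hqhat n ω
    rw [hqn, hSn, hLn]
    ring
  -- the limit of the normalized variance
  have hav : Tendsto (fun n : ℕ => (n : ℝ) * PriorEstimation.avar μ g (X 0) θ₀ n (r n))
      atTop (𝓝 σ2) := by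
    rw [hσ2]
    refine ((hrγ.inv₀ hγ.ne').mul_const _ |>.const_add _).congr' ?_
    filter_upwards [eventually_gt_atTop 0] with n hn
    have hn' : (n : ℝ) ≠ 0 := by exact_mod_cast hn.ne'
    rw [PriorEstimation.avar, mul_add, ← mul_assoc, ← mul_assoc, mul_one_div_cancel hn', one_mul,
      inv_div, mul_one_div]
  have hqm : ∀ n, Measurable (qhat n) := fun n => by
    have : qhat n = fun ω => (1 / (n : ℝ)) * ∑ i ∈ Finset.range n, g (X i ω) (θhat n ω) :=
      funext fun ω => hqhat n ω
    rw [this]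
    exact (Finset.measurable_fun_sum _ fun i _ =>
      hreg.measurable.comp ((hX i).prodMk (hθmeas n))).const_mul _
  have hclt : TendstoInDistribution (fun (n : ℕ) ω => √(n : ℝ) * (qhat n ω - q)) atTop
      (id : ℝ → ℝ) (fun _ => μ) (gaussianReal 0 σ2.toNNReal) := by
    have h := PriorEstimation.clt_sum_of_averages hZindep hZident hu hv hu0 hv0 huv hr hγ hrγ
      (s := σ2) (by rw [hσ2, hVu2, hv2])
    -- Slutsky: the estimation error and `L n + S n` differ by the negligible remainder `hrem`.
    refine tendstoInDistribution_of_tendstoInMeasure_sub _ _ h ?_ fun n =>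
      (((hqm n).sub_const q).const_mul _).aemeasurable
    refine hrem.congr_left fun n => ae_of_all _ fun ω => ?_
    simp only [hLeq, hSeq, Pi.sub_apply]
    ring
  refine ⟨⟨hσ0, hav, hclt⟩, fun hσ => ?_, hrem, fun n hrn => ⟨hLm n, hSm n, ?_, ?_, ?_⟩⟩
  · have h := PriorEstimation.tendstoInDistribution_div_sqrt hσ hclt hav
    refine h.congr (fun n => ae_of_all _ fun ω => ?_) (EventuallyEq.refl _ _)
    -- At `n = 0` also `r 0 = 0`, and both sides are 0 by the convention for division by zero.
    rcases Nat.eq_zero_or_pos n with rfl | hn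
    · have : r 0 = 0 := Nat.le_zero.1 (hr 0)
      simp [PriorEstimation.avar, this]
    · have hn' : (0 : ℝ) < n := by exact_mod_cast hn
      have hsn : √(n : ℝ) ≠ 0 := (Real.sqrt_pos.2 hn').ne'
      rw [Real.sqrt_mul hn'.le, mul_inv, mul_mul_mul_comm, mul_comm (√(n : ℝ)), mul_assoc,
        mul_comm]
      field_simp
  · rw [hLeq, hSeq, covariance_const_mul_left, covariance_const_mul_right,
      PriorEstimation.covariance_sum_sum_eq hZindep hZident hu hv (hr n), hcuv]
    simp
  · have hn' : (n : ℝ) ≠ 0 := by exact_mod_cast (hrn.trans_le (hr n)).ne'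
    rw [hLeq, variance_const_mul, PriorEstimation.variance_sum_eq hZindep hZident hu, hVu]
    field_simp
  · have hr' : (r n : ℝ) ≠ 0 := by exact_mod_cast hrn.ne'
    rw [hSeq, variance_const_mul, PriorEstimation.variance_sum_eq hZindep hZident hv, hVv]
    field_simp
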